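/- Let $M$ be a complete connected Riemannian $n$-manifold, let $p\colon\widetilde M\to M$ be its Riemannian universal cover, and let $\Gamma=\pi_1(M)$ act on $\widetilde M$ by deck transformations. Write $\Delta_k(\widetilde M)$ for the set of singular $k$-simplices $\Delta^k\to\widetilde M$. A family of maps $S_k\colon\Delta_k(\widetilde M)\to\Delta_k(\widetilde M)$, $0\le k\le n$, is called a straightening on $M$ if 1. each $S_k$ is $\Gamma$-equivariant: $S_k(\gamma\sigma)=\gamma S_k(\sigma)$ for all $\gamma\in\Gamma$, $\sigma\in\Delta_k(\widetilde M)$; 2. in degrees $\le n$ the linear extensions of the $S_k$ to $C_k(\widetilde M,\mathbb R)$ commute with the boundary maps and are $\Gamma$-equivariantly chain homotopic to the identity: there are $\Gamma$-equivariant linear maps $H_k\colon C_k(\widetilde M,\mathbb R)\to C_{k+1}(\widetilde M,\mathbb R)$, $0\le k\le n$, with $S_k-\mathrm{id}=\partial H_k+H_{k-1}\partial$ (where $H_{-1}=0$). For a $C^1$ simplex $\sigma\colon\Delta^k\to\widetilde M$ let $\mathrm{vol}_k(\sigma)=\int_{\Delta^k}\|d\sigma(e_1)\wedge\dots\wedge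 d\sigma(e_k)\|\,dV_{\Delta}$, where $e_1,\dots,e_k$ is an orthonormal frame of $\Delta^k$ (for any Riemannian metric on $\Delta^k$, with volume form $dV_\Delta$). For $\alpha\in H_k(M,\mathbb R)$ (singular homology) let $$\|\alpha\|_1=\inf\Big\{\sum_i|a_i| \;:\; \alpha=\Big[\sum_i a_i\sigma_i\Big]\Big\}$$ over all real singular cycles that represent $\alpha$, and let $$\mathrm{mass}(\alpha)=\sup\Big\{\int_\alpha\omega \;:\; \omega\text{ a closed smooth differential }k\text{-form on }M,\ \mathrm{comass}(\omega)\le 1\Big\},$$ where $\mathrm{comass}(\omega)=\sup\{|\omega_q(x_1,\dots,x_k)| : q\in M,\ x_1,\dots,x_k\in T_qM\text{ unit vectors}\}$ and $\int_\alpha\omega$ is the integral of $\omega$ over any cycle of $C^1$ simplices that represents $\alpha$. Suppose that $M$ admits a straightening $\{S_k\}$, let $0\le k\le n$, and suppose that for every singular $k$-simplex $\sigma$ of $\widetilde M$ the simplex $S_k(\sigma)$ is $C^1$ with $\mathrm{vol}_k(S_k(\sigma))\le C_k$, where $C_k>0$ is a constant. Then for every $\alpha\in H_k(M,\mathbb R)$,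 $$\|\alpha\|_1\ge\frac1{C_k}\,\mathrm{mass}(\alpha).$$ -/

import Mathlib

open CategoryTheory Limits Bundle Manifold MeasureTheory
open scoped ENNReal ContDiff Simplicial

universe u

noncomputable section

/-! ### Singular chains and homology with real coefficients -/

/-- The coefficients `ℝ`, lifted to the universe of the space. -/
abbrev RealCoeff : ModuleCat.{u} ℝ := ModuleCat.of ℝ (ULift.{u} ℝ)

/-- The real singular chain complex `C_*(X, ℝ)`. -/
abbrev SingularChains (X : Type u) [TopologicalSpace X] : ChainComplex (ModuleCat.{u} ℝ) ℕ :=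
  (TopCat.toSSet.obj (TopCat.of X)).chainComplex RealCoeff.{u}

/-- The real singular homology `H_k(X, ℝ)`. -/
abbrev SingularHomology (X : Type u) [TopologicalSpace X] (k : ℕ) : ModuleCat.{u} ℝ :=
  (SingularChains X).homology k

/-- These are Mathlib's singular homology groups. -/
theorem singularHomology_eq (X : Type u) [TopologicalSpace X] (k : ℕ) :
    SingularHomology X k =
      ((AlgebraicTopology.singularHomologyFunctor (ModuleCat.{u} ℝ) k).obj RealCoeff.{u}).obj
        (TopCat.of X) := rfl

/-- The set `Δ_k(X)` of singular `k`-simplices of `X`. -/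
abbrev SingularSimplex (X : Type u) [TopologicalSpace X] (k : ℕ) : Type u :=
  C(stdSimplex ℝ (Fin (k + 1)), X)

section Chains

variable {X : Type u} [TopologicalSpace X] {k : ℕ}

/-- The inclusion of the summand of `C_k(X, ℝ)` that belongs to the simplex `σ`. -/
def simplexIncl (σ : SingularSimplex X k) : RealCoeff.{u} ⟶ (SingularChains X).X k :=
  SSet.ιChainComplex (X := TopCat.toSSet.obj (TopCat.of X)) ((TopCat.toSSetObjEquiv (TopCat.of X) (.op ⦋k⦌)).symm σ)

/-- A singular simplex as a basis element of `C_k(X, ℝ)`. -/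
def simplexChain (σ : SingularSimplex X k) : (SingularChains X).X k :=
  (simplexIncl σ).hom (ULift.up 1)

/-- The chain `∑ i, a_i σ_i`. -/
def chainOf (c : SingularSimplex X k →₀ ℝ) : (SingularChains X).X k :=
  Finsupp.linearCombination ℝ simplexChain c

/-- The chain `∑ i, a_i σ_i` is a cycle and its homology class is `α`. -/
def Represents (c : SingularSimplex X k →₀ ℝ) (α : SingularHomology X k) : Prop :=
  ∃ z : (SingularChains X).cycles k,
    ((SingularChains X).iCycles k).hom z = chainOf c ∧ ((SingularChains X).homologyπ k).hom z = α

/-- The Gromov norm `‖α‖₁`: the infimum of `∑ i, |a_i|` over the cycles that represent `α`. -/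
def gromovNorm (α : SingularHomology X k) : ℝ≥0∞ :=
  ⨅ (c : SingularSimplex X k →₀ ℝ) (_ : Represents c α), ENNReal.ofReal (c.sum fun _ a => |a|)

/-- The linear extension to chains of a self-map of the set of singular `k`-simplices. -/
def extendToChains (S : SingularSimplex X k → SingularSimplex X k) :
    (SingularChains X).X k ⟶ (SingularChains X).X k :=
  Sigma.desc fun x => simplexIncl (S (TopCat.toSSetObjEquiv (TopCat.of X) (.op ⦋k⦌) x))

/-- The map induced on singular chains by a continuous map. -/
def chainsMap {Y : Type u} [TopologicalSpace Y] (f : C(X, Y)) :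
    SingularChains X ⟶ SingularChains Y :=
  SSet.chainComplexMap (TopCat.toSSet.map (TopCat.ofHom f)) RealCoeff.{u}

end Chains

/-! ### Differential forms -/

section Forms

variable (n : ℕ) {M : Type u} [TopologicalSpace M] [ChartedSpace (EuclideanSpace ℝ (Fin n)) M]
  {k : ℕ}

/-- A field of alternating `k`-forms on the tangent spaces of `M`, not necessarily continuous. -/
abbrev FormField (M : Type u) [TopologicalSpace M] [ChartedSpace (EuclideanSpace ℝ (Fin n)) M]
    (k : ℕ) : Type u :=
  ∀ x : M, TangentSpace (𝓡 n) x [⋀^Fin k]→L[ℝ] ℝ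

variable {n}

/-- The form `η` in the chart at `x₀`: its pullback by the inverse of that chart. -/
def FormField.inChart (η : FormField n M k) (x₀ : M) (y : EuclideanSpace ℝ (Fin n)) :
    EuclideanSpace ℝ (Fin n) [⋀^Fin k]→L[ℝ] ℝ :=
  (η ((extChartAt (𝓡 n) x₀).symm y)).compContinuousLinearMap
    (mfderiv 𝓘(ℝ, EuclideanSpace ℝ (Fin n)) (𝓡 n) (extChartAt (𝓡 n) x₀).symm y)

/-- `η` is a closed (smooth) differential form. -/
structure FormField.IsClosedForm (η : FormField n M k) : Prop where
  smooth : ∀ x₀ : M, ContDiffOn ℝ ∞ (η.inChart x₀) (extChartAt (𝓡 n) x₀).target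
  closed : ∀ x₀ : M, ∀ y ∈ (extChartAt (𝓡 n) x₀).target, extDeriv (η.inChart x₀) y = 0

/-- The comass of a form: the supremum of `|η_p(x_1, …, x_k)|` over all points `p` and unit vectors
`x_1, …, x_k` at `p`. The absolute value only matters for `k = 0`. -/
def FormField.comass [RiemannianBundle (fun x : M => TangentSpace (𝓡 n) x)]
    (η : FormField n M k) : ℝ≥0∞ :=
  ⨆ (p : M) (v : Fin k → TangentSpace (𝓡 n) p) (_ : ∀ i, ‖v i‖ = 1), ‖η p v‖ₑ

end Forms

/-! ### `C¹` simplices -/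

/-- The simplex in `ℝ^k` with vertices `0, e_1, …, e_k`. -/
def cornerSimplex (k : ℕ) : Set (Fin k → ℝ) := {t | (∀ i, 0 ≤ t i) ∧ ∑ i, t i ≤ 1}

/-- The affine identification of the simplex `[0, e_1, …, e_k]` with the standard simplex that
preserves the order of the vertices, `t ↦ (1 - ∑ i, t i, t_1, …, t_k)`. -/
def cornerToStd {k : ℕ} (t : cornerSimplex k) : stdSimplex ℝ (Fin (k + 1)) :=
  ⟨Fin.cons (1 - ∑ i, t.1 i) t.1, by
    refine ⟨fun i => ?_, by simp [Fin.sum_univ_succ]⟩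
    refine Fin.cases ?_ (fun j => ?_) i
    · simpa using t.2.2
    · simpa using t.2.1 j⟩

section C1

variable {n : ℕ} {M : Type u} [TopologicalSpace M] [ChartedSpace (EuclideanSpace ℝ (Fin n)) M]
  {k : ℕ}

open Classical in
/-- A singular simplex written as a map on `[0, e_1, …, e_k] ⊆ ℝ^k`; its values elsewhere are
irrelevant. -/
def simplexInCoords {X : Type u} [TopologicalSpace X] {k : ℕ} (σ : SingularSimplex X k)
    (t : Fin k → ℝ) : X :=
  if h : t ∈ cornerSimplex k then σ (cornerToStd ⟨t, h⟩) else σ (stdSimplex.vertex 0)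

variable (n) in
/-- `σ` is `C¹` on the closed simplex. -/
def IsC1Simplex (σ : SingularSimplex M k) : Prop :=
  ContMDiffOn 𝓘(ℝ, Fin k → ℝ) (𝓡 n) 1 (simplexInCoords σ) (cornerSimplex k)

variable (n) in
/-- The vector `dσ(e_i)` at the point `t` of the simplex. -/
def simplexTangent (σ : SingularSimplex M k) (t : Fin k → ℝ) (i : Fin k) :
    TangentSpace (𝓡 n) (simplexInCoords σ t) :=
  mfderivWithin 𝓘(ℝ, Fin k → ℝ) (𝓡 n) (simplexInCoords σ) (cornerSimplex k) t
    (Pi.single i (1 : ℝ) : Fin k → ℝ)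

variable (n) in
/-- The `k`-Jacobian `‖dσ(e_1) ∧ … ∧ dσ(e_k)‖`, the square root of a Gram determinant. As the
simplex is `k`-dimensional, every orthonormal `k`-frame gives the same value. -/
def simplexJacobian [RiemannianBundle (fun x : M => TangentSpace (𝓡 n) x)]
    (σ : SingularSimplex M k) (t : Fin k → ℝ) : ℝ :=
  Real.sqrt (Matrix.of fun i j : Fin k =>
    (inner ℝ (simplexTangent n σ t i) (simplexTangent n σ t j) : ℝ)).det

variable (n) in
/-- The `k`-dimensional volume of a `C¹` simplex. -/
def simplexVolume [RiemannianBundle (fun x : M => TangentSpace (𝓡 n) x)]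
    (σ : SingularSimplex M k) : ℝ≥0∞ :=
  ∫⁻ t in cornerSimplex k, ENNReal.ofReal (simplexJacobian n σ t)

/-- The integral of a form over a `C¹` simplex. -/
def FormField.integralSimplex (η : FormField n M k) (σ : SingularSimplex M k) : ℝ :=
  ∫ t in cornerSimplex k, η (simplexInCoords σ t) (simplexTangent n σ t)

/-- `r = ∫_α η` for a closed form `η`: the integral of `η` over some (equivalently, by Stokes'
theorem, any) cycle of `C¹` simplices that represents `α` in singular homology. -/
def FormField.IsIntegralOver (η : FormField n M k) (α : SingularHomology M k) (r : ℝ) : Prop :=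
  ∃ c : SingularSimplex M k →₀ ℝ, (∀ σ ∈ c.support, IsC1Simplex n σ) ∧ Represents c α ∧
    r = c.sum fun σ a => a * η.integralSimplex σ

variable (n) in
/-- The mass of a homology class: the supremum of `∫_α η` over the closed forms `η` of comass at
most `1`. It is nonnegative, as `η = 0` is allowed, and so it is taken in `[0, ∞]`. -/
def mass [RiemannianBundle (fun x : M => TangentSpace (𝓡 n) x)] (α : SingularHomology M k) :
    ℝ≥0∞ :=
  ⨆ (η : FormField n M k) (_ : η.IsClosedForm) (_ : η.comass ≤ 1) (r : ℝ)
    (_ : η.IsIntegralOver α r), ENNReal.ofReal r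

end C1

/-! ### Universal covers and straightenings -/

/-- `p : N → M` is the Riemannian universal cover of `M`. -/
structure IsRiemannianUniversalCover (n : ℕ) {M N : Type u}
    [TopologicalSpace M] [ChartedSpace (EuclideanSpace ℝ (Fin n)) M]
    [RiemannianBundle (fun x : M => TangentSpace (𝓡 n) x)]
    [TopologicalSpace N] [ChartedSpace (EuclideanSpace ℝ (Fin n)) N]
    [RiemannianBundle (fun x : N => TangentSpace (𝓡 n) x)] (p : N → M) : Prop where
  simplyConnected : SimplyConnectedSpace N
  isCoveringMap : IsCoveringMap p
  smooth : ContMDiff (𝓡 n) (𝓡 n) ∞ p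
  isometric : ∀ (x : N) (v : TangentSpace (𝓡 n) x), ‖mfderiv (𝓡 n) (𝓡 n) p x v‖ = ‖v‖

/-- The group of deck transformations of `p : N → M`; for the universal cover this is the
fundamental group `Γ` of `M` with its action on `N`. -/
def deckGroup {M N : Type u} [TopologicalSpace N] (p : N → M) : Subgroup (N ≃ₜ N) where
  carrier := {γ | ∀ x, p (γ x) = p x}
  one_mem' _ := rfl
  mul_mem' {a b} ha hb x := (ha (b x)).trans (hb x)
  inv_mem' {a} ha x := by
    have h := ha (a⁻¹ x)
    rw [← h]
    exact congrArg p (a.apply_symm_apply x)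

/-- The family `S_0, …, S_n` of self-maps of the sets of singular simplices of the universal cover
`p : N → M` of an `n`-manifold is a straightening (the `S k` with `k > n` play no role). -/
structure IsStraightening (n : ℕ) {M N : Type u} [TopologicalSpace N] (p : N → M)
    (S : ∀ k : ℕ, SingularSimplex N k → SingularSimplex N k) : Prop where
  equivariant : ∀ k ≤ n, ∀ γ ∈ deckGroup p, ∀ σ : SingularSimplex N k,
    S k ((γ : C(N, N)).comp σ) = (γ : C(N, N)).comp (S k σ)
  chainMap : ∀ k, k + 1 ≤ n →
    extendToChains (S (k + 1)) ≫ (SingularChains N).d (k + 1) k =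
      (SingularChains N).d (k + 1) k ≫ extendToChains (S k)
  homotopy : ∃ H : ∀ k : ℕ, (SingularChains N).X k ⟶ (SingularChains N).X (k + 1),
    (∀ k ≤ n, ∀ γ ∈ deckGroup p,
      (chainsMap (γ : C(N, N))).f k ≫ H k = H k ≫ (chainsMap (γ : C(N, N))).f (k + 1)) ∧
    extendToChains (S 0) - 𝟙 _ = H 0 ≫ (SingularChains N).d 1 0 ∧
    ∀ k, k + 1 ≤ n → extendToChains (S (k + 1)) - 𝟙 _ =
      (SingularChains N).d (k + 1) k ≫ H k + H (k + 1) ≫ (SingularChains N).d (k + 2) (k + 1)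

end

/-! Let `c = ∑ a_i σ_i` be any singular cycle in the class `α`, and let `η` be a closed form of
comass at most `1`. Lift each `σ_i` to the universal cover, straighten the lift and project it back
to `M`. By equivariance, the straightening and its homotopy to the identity descend to chains of `M`
(`chainsMap_chainsDescend`), so the straightened cycle is homologous to `c`
(`IsStraightening.exists_boundary`). Its simplices are `C¹`, so `η` may be integrated over it. Each
of them contributes at most `C` in absolute value: comass at most `1` bounds `|η(w_1, …, w_k)|` by
the square root of the Gram determinant, by Gram–Schmidt, and `p` is isometric. Hence `∫_α η ≤ C ∑
|a_i|`. The supremum over `η` and the infimum over `c` give the theorem.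

The main work is to show that `∫_α η` does not depend on the `C¹` cycle
(`FormField.IsClosedForm.sum_integralSimplex_eq_zero`). Two `C¹` cycles in one class differ by the
boundary of a chain `b` whose simplices are only continuous, so Stokes' theorem does not apply to
`b` directly. The simplices of `b` have to be smoothed, compatibly with all faces, and in such a way
that simplices that are already `C¹` change little in `C¹`.

Bernstein polynomials on the simplex do this. Their restriction to a face is the Bernstein
polynomial of the restriction, so the smoothing commutes with face maps exactly. They converge
uniformly for continuous functions, and together with first derivatives for `C¹` functions. Here
they are averages over a random walk; convergence is Chebyshev's inequality, and differentiation
turns them into averages of difference quotients. On a manifold they are used in one chart at a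
time, blended with the old map by a cutoff function, and finitely many charts that cover the image
of `b` are treated in turn.

For a large degree `m` all smoothed simplices of `b` are `C^∞`. Stokes' theorem on the corner
simplex then makes the integral over the smoothed boundary zero, and `m → ∞` gives the integral over
the original `C¹` boundary. -/

noncomputable section

open Filter Topology Set

/-! ### Continuous convergence -/

/-- Continuous convergence of the sequence `f` to `g` on `s`: `f m x` tends to `g t` as `m → ∞` and
`x → t` in `s`. -/
def TendstoContinuouslyOn {X Y : Type*} [TopologicalSpace X] [TopologicalSpace Y]
    (f : ℕ → X → Y) (g : X → Y) (s : Set X) : Prop :=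
  ∀ t ∈ s, Tendsto (fun q : ℕ × X => f q.1 q.2) (atTop ×ˢ 𝓝[s] t) (𝓝 (g t))

/-- The reason for using continuous convergence: around each point one bound on the index serves a
whole neighbourhood, and finitely many neighbourhoods cover `s`. -/
theorem IsCompact.eventually_atTop_forall {X : Type*} [TopologicalSpace X] {s : Set X}
    (hs : IsCompact s) {P : ℕ → X → Prop}
    (h : ∀ t ∈ s, ∀ᶠ q : ℕ × X in atTop ×ˢ 𝓝[s] t, P q.1 q.2) :
    ∀ᶠ m in atTop, ∀ t ∈ s, P m t := by
  refine hs.induction_on (p := fun S => ∀ᶠ m in atTop, ∀ t ∈ S, P m t) (by simp) ?_ ?_ ?_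
  · exact fun S T hST hT => hT.mono fun m hm t ht => hm t (hST ht)
  · intro S T hS hT
    filter_upwards [hS, hT] with m h1 h2 t ht
    exact ht.elim (h1 t) (h2 t)
  · intro t ht
    obtain ⟨pa, ha, pb, hb, hab⟩ := eventually_prod_iff.1 (h t ht)
    exact ⟨{x | pb x}, hb, ha.mono fun m hm x hx => hab hm hx⟩

/-- A derivative at a moving point depends on the germ there, so identities between maps are needed
on a neighbourhood of that point and not just at it. -/
theorem eventually_prod_eventually_nhdsWithin {X : Type*} [TopologicalSpace X] {s : Set X} {t : X}
    {P : ℕ → X → Prop} (h : ∀ᶠ q : ℕ × X in atTop ×ˢ 𝓝[s] t, P q.1 q.2) :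
    ∀ᶠ q : ℕ × X in atTop ×ˢ 𝓝[s] t, ∀ᶠ x in 𝓝[s] q.2, P q.1 x := by
  obtain ⟨pa, ha, pb, hb, hab⟩ := eventually_prod_iff.1 h
  refine eventually_prod_iff.2 ⟨pa, ha, _, eventually_eventually_nhdsWithin.2 hb, ?_⟩
  exact fun {m} hm {x} hx => hx.mono fun y hy => hab hm hy

theorem TendstoContinuouslyOn.exists_bound {X E : Type*} [TopologicalSpace X]
    [NormedAddCommGroup E] {f : ℕ → X → E} {g : X → E} {s : Set X} (hs : IsCompact s)
    (h : TendstoContinuouslyOn f g s) : ∃ K, ∀ᶠ m in atTop, ∀ t ∈ s, ‖f m t‖ ≤ K := by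
  refine hs.induction_on (p := fun S => ∃ K, ∀ᶠ m in atTop, ∀ t ∈ S, ‖f m t‖ ≤ K)
    ⟨0, by simp⟩ ?_ ?_ ?_
  · exact fun S T hST ⟨K, hT⟩ => ⟨K, hT.mono fun m hm t ht => hm t (hST ht)⟩
  · rintro S T ⟨K, hS⟩ ⟨L, hT⟩
    refine ⟨max K L, ?_⟩
    filter_upwards [hS, hT] with m h1 h2 t ht
    exact ht.elim (fun h => (h1 t h).trans (le_max_left _ _))
      fun h => (h2 t h).trans (le_max_right _ _)
  · intro t ht
    have h' := (h t ht).norm.eventually (gt_mem_nhds (lt_add_one ‖g t‖))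
    obtain ⟨pa, ha, pb, hb, hab⟩ := eventually_prod_iff.1 h'
    exact ⟨{x | pb x}, hb, _, ha.mono fun m hm x hx => (hab hm hx).le⟩

/-! ### Bernstein operators on the corner simplex -/

theorem convex_cornerSimplex (k : ℕ) : Convex ℝ (cornerSimplex k) := by
  intro x hx y hy a b ha hb hab
  refine ⟨fun i => ?_, ?_⟩
  · have := mul_nonneg ha (hx.1 i)
    have := mul_nonneg hb (hy.1 i)
    simp; linarith
  · simp only [Pi.add_apply, Pi.smul_apply, smul_eq_mul, Finset.sum_add_distrib, ← Finset.mul_sum]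
    nlinarith [hx.2, hy.2]

theorem isClosed_cornerSimplex (k : ℕ) : IsClosed (cornerSimplex k) := by
  have : cornerSimplex k = (⋂ i, {t | 0 ≤ t i}) ∩ {t | ∑ i, t i ≤ 1} := by
    ext t; simp [cornerSimplex]
  rw [this]
  exact (isClosed_iInter fun i => isClosed_le continuous_const (continuous_apply i)).inter
    (isClosed_le (by fun_prop) continuous_const)

theorem cornerSimplex_subset_Icc (k : ℕ) : cornerSimplex k ⊆ Icc 0 1 := by
  intro t ht
  refine ⟨fun i => ht.1 i, fun i => ?_⟩
  exact (Finset.single_le_sum (fun j _ => ht.1 j) (Finset.mem_univ i)).trans ht.2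

theorem isCompact_cornerSimplex (k : ℕ) : IsCompact (cornerSimplex k) :=
  isCompact_Icc.of_isClosed_subset (isClosed_cornerSimplex k) (cornerSimplex_subset_Icc k)

theorem interior_cornerSimplex_nonempty (k : ℕ) : (interior (cornerSimplex k)).Nonempty := by
  refine ⟨fun _ => 1 / (k + 1 : ℝ), mem_interior.2
    ⟨(⋂ i, {t | 0 < t i}) ∩ {t | ∑ i, t i < 1}, ?_, ?_, ?_⟩⟩
  · rintro t ⟨h1, h2⟩
    simp only [mem_iInter, mem_ofPred_eq] at h1 h2
    exact ⟨fun i => (h1 i).le, h2.le⟩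
  · exact (isOpen_iInter_of_finite fun i => isOpen_lt continuous_const (continuous_apply i)).inter
      (isOpen_lt (by fun_prop) continuous_const)
  · refine ⟨mem_iInter.2 fun i => by simp only [mem_ofPred_eq]; positivity, ?_⟩
    simp only [mem_ofPred_eq, Finset.sum_const, Finset.card_univ, Fintype.card_fin, nsmul_eq_mul]
    rw [mul_one_div, div_lt_one (by positivity)]
    linarith

theorem uniqueDiffOn_cornerSimplex (k : ℕ) : UniqueDiffOn ℝ (cornerSimplex k) :=
  uniqueDiffOn_convex (convex_cornerSimplex k) (interior_cornerSimplex_nonempty k)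

theorem cornerSimplex_subset_closure_interior (k : ℕ) :
    cornerSimplex k ⊆ closure (interior (cornerSimplex k)) := by
  rw [(convex_cornerSimplex k).closure_interior_eq_closure_of_nonempty_interior
    (interior_cornerSimplex_nonempty k)]
  exact subset_closure

section Bernstein

variable {k : ℕ} {E : Type*} [NormedAddCommGroup E] [NormedSpace ℝ E]

/-- The average of `G` over the end points of one step of the random walk that starts at `y` and
whose steps are `0, e_1, …, e_k` with the probabilities `1 - ∑ i, t_i, t_1, …, t_k`. -/
def walkStep (t : Fin k → ℝ) (G : (Fin k → ℝ) → E) (y : Fin k → ℝ) : E :=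
  (1 - ∑ i, t i) • G y + ∑ i, t i • G (y + Pi.single i 1)

/-- The average of `G` over the end points of the random walks of length `m` that start at `y`. -/
def walkAverage (m : ℕ) (t : Fin k → ℝ) (G : (Fin k → ℝ) → E) : (Fin k → ℝ) → E :=
  (walkStep t)^[m] G

theorem walkAverage_succ (m : ℕ) (t : Fin k → ℝ) (G : (Fin k → ℝ) → E) (y : Fin k → ℝ) :
    walkAverage (m + 1) t G y = (1 - ∑ i, t i) • walkAverage m t G y +
      ∑ i, t i • walkAverage m t G (y + Pi.single i 1) := by
  rw [walkAverage, Function.iterate_succ_apply']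
  rfl

theorem walkAverage_add (m : ℕ) (t : Fin k → ℝ) (G H : (Fin k → ℝ) → E) (y : Fin k → ℝ) :
    walkAverage m t (fun z => G z + H z) y = walkAverage m t G y + walkAverage m t H y := by
  induction m generalizing y with
  | zero => rfl
  | succ m ih => simp only [walkAverage_succ, ih, smul_add, Finset.sum_add_distrib]; abel

theorem walkAverage_smul (m : ℕ) (t : Fin k → ℝ) (c : ℝ) (G : (Fin k → ℝ) → E) (y : Fin k → ℝ) :
    walkAverage m t (fun z => c • G z) y = c • walkAverage m t G y := by
  induction m generalizing y with
  | zero => rfl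
  | succ m ih =>
    simp only [walkAverage_succ, ih, smul_add, Finset.smul_sum]
    congr 1
    · rw [smul_comm]
    · exact Finset.sum_congr rfl fun i _ => smul_comm _ _ _

theorem walkAverage_sub (m : ℕ) (t : Fin k → ℝ) (G H : (Fin k → ℝ) → E) (y : Fin k → ℝ) :
    walkAverage m t (fun z => G z - H z) y = walkAverage m t G y - walkAverage m t H y := by
  have := walkAverage_add m t (fun z => G z - H z) H y
  simp only [sub_add_cancel] at this
  exact eq_sub_of_add_eq this.symm

theorem walkAverage_const (m : ℕ) (t : Fin k → ℝ) (c : E) (y : Fin k → ℝ) :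
    walkAverage m t (fun _ => c) y = c := by
  induction m generalizing y with
  | zero => rfl
  | succ m ih => simp only [walkAverage_succ, ih, ← Finset.sum_smul, ← add_smul]; simp

theorem walkAverage_sum {ι : Type*} (s : Finset ι) (m : ℕ) (t : Fin k → ℝ)
    (G : ι → (Fin k → ℝ) → E) (y : Fin k → ℝ) :
    walkAverage m t (fun z => ∑ j ∈ s, G j z) y = ∑ j ∈ s, walkAverage m t (G j) y := by
  classical
  induction s using Finset.induction_on with
  | empty => simpa using walkAverage_const m t (0 : E) y
  | insert a s ha ih => simp only [Finset.sum_insert ha, walkAverage_add, ih]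

theorem walkAverage_comp_add (m : ℕ) (t : Fin k → ℝ) (G : (Fin k → ℝ) → E) (a y : Fin k → ℝ) :
    walkAverage m t (fun z => G (z + a)) y = walkAverage m t G (y + a) := by
  induction m generalizing y with
  | zero => rfl
  | succ m ih => simp only [walkAverage_succ, ih, add_right_comm]

/-- For `t` in the simplex the weights are probabilities, so averaging is monotone. A walk of `m`
steps from `y` stays in the region where `h` is assumed, and nothing is asked of `G` elsewhere. -/
theorem norm_walkAverage_le {t : Fin k → ℝ} (ht : t ∈ cornerSimplex k) {G : (Fin k → ℝ) → E}
    {H : (Fin k → ℝ) → ℝ} (m : ℕ) {r : ℝ} {y : Fin k → ℝ} (hy : ∀ i, 0 ≤ y i)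
    (hyr : ∑ i, y i ≤ r) (h : ∀ z : Fin k → ℝ, (∀ i, 0 ≤ z i) → ∑ i, z i ≤ r + m → ‖G z‖ ≤ H z) :
    ‖walkAverage m t G y‖ ≤ walkAverage m t H y := by
  induction m generalizing r y with
  | zero => exact h y hy (by simpa using hyr)
  | succ m ih =>
    rw [walkAverage_succ, walkAverage_succ]
    have h0 : 0 ≤ 1 - ∑ i, t i := sub_nonneg.2 ht.2
    refine (norm_add_le _ _).trans (add_le_add ?_ ((norm_sum_le _ _).trans
      (Finset.sum_le_sum fun i _ => ?_)))
    · rw [norm_smul, Real.norm_of_nonneg h0]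
      refine mul_le_mul_of_nonneg_left (ih hy hyr fun z hz hzr => h z hz ?_) h0
      push_cast; linarith
    · rw [norm_smul, Real.norm_of_nonneg (ht.1 i)]
      refine mul_le_mul_of_nonneg_left (ih (r := r + 1) ?_ ?_ fun z hz hzr => h z hz ?_) (ht.1 i)
      · intro j
        have : (0 : ℝ) ≤ (Pi.single i (1 : ℝ) : Fin k → ℝ) j := by
          by_cases hij : j = i <;> simp [hij]
        exact add_nonneg (hy j) this
      · simp [Finset.sum_add_distrib, hyr]
      · push_cast; linarith

/-- Squared bias plus variance: the `j`-th coordinate of the walk is `y j` plus a binomial variable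
with parameters `m` and `t j`. -/
theorem walkAverage_sq (m : ℕ) (t : Fin k → ℝ) (j : Fin k) (a : ℝ) (y : Fin k → ℝ) :
    walkAverage m t (fun z => (z j - a) ^ 2) y =
      (y j + m * t j - a) ^ 2 + m * (t j * (1 - t j)) := by
  induction m generalizing y with
  | zero => simp [walkAverage]
  | succ m ih =>
    simp only [walkAverage_succ, ih, smul_eq_mul]
    have key : ∀ i, t i * (((y + Pi.single i (1 : ℝ) : Fin k → ℝ) j + m * t j - a) ^ 2 +
        m * (t j * (1 - t j))) = t i * ((y j + m * t j - a) ^ 2 + m * (t j * (1 - t j))) +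
          (if i = j then t i * (2 * (y j + m * t j - a) + 1) else 0) := by
      intro i
      by_cases hij : i = j
      · subst hij; simp; ring
      · simp [hij]
    simp only [key, Finset.sum_add_distrib, ← Finset.sum_mul, Finset.sum_ite_eq',
      Finset.mem_univ, if_true]
    push_cast; ring

theorem contDiff_walkAverage (m : ℕ) (G : (Fin k → ℝ) → E) (y : Fin k → ℝ) {r : WithTop ℕ∞} :
    ContDiff ℝ r fun t => walkAverage m t G y := by
  induction m generalizing y with
  | zero => exact contDiff_const
  | succ m ih =>
    simp only [walkAverage_succ]
    have := ih
    fun_prop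

/-- Differentiating the weights of one step in `t i` yields the forward difference in direction
`e_i`. The steps commute, so each of the `m + 1` steps contributes the same term. -/
theorem fderiv_walkAverage_single (m : ℕ) (t : Fin k → ℝ) (G : (Fin k → ℝ) → E) (y : Fin k → ℝ)
    (i : Fin k) :
    fderiv ℝ (fun t => walkAverage (m + 1) t G y) t (Pi.single i 1) =
      (m + 1 : ℝ) • walkAverage m t (fun z => G (z + Pi.single i 1) - G z) y := by
  have hd : ∀ m y, DifferentiableAt ℝ (fun t => walkAverage m t G y) t := fun m y =>
    (contDiff_walkAverage m G y (r := 1)).differentiable (by simp) t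
  have hp : ∀ j, DifferentiableAt ℝ (fun t : Fin k → ℝ => t j) t := fun j => by fun_prop
  have hs : DifferentiableAt ℝ (fun t : Fin k → ℝ => 1 - ∑ i, t i) t := by fun_prop
  -- Product rule: either the other `m` steps are differentiated, or the weights of the first step
  -- are.
  have hstep : ∀ m y, fderiv ℝ (fun t => walkAverage (m + 1) t G y) t (Pi.single i 1) =
      ((1 - ∑ i, t i) • fderiv ℝ (fun t => walkAverage m t G y) t (Pi.single i 1) +
        ∑ j, t j • fderiv ℝ (fun t => walkAverage m t G (y + Pi.single j 1)) t (Pi.single i 1)) +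
      walkAverage m t (fun z => G (z + Pi.single i 1) - G z) y := by
    intro m y
    have h1 : HasFDerivAt (fun t : Fin k → ℝ => 1 - ∑ i, t i)
        (-∑ j, ContinuousLinearMap.proj (R := ℝ) (φ := fun _ : Fin k => ℝ) j) t := by
      have := HasFDerivAt.fun_sum (u := Finset.univ) (x := t)
        fun j _ => hasFDerivAt_apply (𝕜 := ℝ) (F' := fun _ : Fin k => ℝ) j t
      exact this.const_sub 1
    have h2 := (h1.fun_smul (hd m y).hasFDerivAt).fun_add (HasFDerivAt.fun_sum (u := Finset.univ)
      fun j _ => (hasFDerivAt_apply (𝕜 := ℝ) (F' := fun _ : Fin k => ℝ) j t).fun_smul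
        (hd m (y + Pi.single j 1)).hasFDerivAt)
    simp only [walkAverage_succ]
    rw [h2.fderiv, walkAverage_sub, walkAverage_comp_add]
    simp [Finset.sum_add_distrib, Pi.single_apply]
    abel
  induction m generalizing y with
  | zero =>
    rw [hstep]
    simp [walkAverage]
  | succ m ih =>
    rw [hstep]
    simp only [ih]
    rw [walkAverage_succ]
    simp only [smul_add, smul_comm _ (m + 1 : ℝ), ← Finset.smul_sum]
    push_cast
    module

/-- The Bernstein polynomial of degree `m` of the function `g` on the corner simplex. -/
def bernsteinCorner (m : ℕ) (g : (Fin k → ℝ) → E) (t : Fin k → ℝ) : E :=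
  walkAverage m t (fun z => g ((m : ℝ)⁻¹ • z)) 0

theorem contDiff_bernsteinCorner (m : ℕ) (g : (Fin k → ℝ) → E) {r : WithTop ℕ∞} :
    ContDiff ℝ r (bernsteinCorner m g) :=
  contDiff_walkAverage m _ _

/-- These points are the nodes of the Bernstein operator. For `m = 0` the convention `0⁻¹ = 0` makes
the node the vertex `0`. -/
theorem inv_smul_mem_cornerSimplex {m : ℕ} {z : Fin k → ℝ} (hz : ∀ i, 0 ≤ z i)
    (hzm : ∑ i, z i ≤ m) : (m : ℝ)⁻¹ • z ∈ cornerSimplex k := by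
  refine ⟨fun i => mul_nonneg (by positivity) (hz i), ?_⟩
  simp only [Pi.smul_apply, smul_eq_mul, ← Finset.mul_sum]
  exact inv_mul_le_one_of_le₀ hzm (by positivity)

theorem bernsteinCorner_congr {m : ℕ} {g h : (Fin k → ℝ) → E} (hgh : EqOn g h (cornerSimplex k))
    {t : Fin k → ℝ} (ht : t ∈ cornerSimplex k) : bernsteinCorner m g t = bernsteinCorner m h t := by
  rw [← sub_eq_zero, ← norm_le_zero_iff, bernsteinCorner, bernsteinCorner, ← walkAverage_sub]
  refine (norm_walkAverage_le ht (H := fun _ => 0) m (r := 0) (by simp) (by simp)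
    fun z hz hzm => ?_).trans (walkAverage_const m t (0 : ℝ) 0).le
  rw [hgh (inv_smul_mem_cornerSimplex hz (by simpa using hzm)), sub_self, norm_zero]

/-- Bernstein's argument: by the variance bound `k / m`, the nodes concentrate near the point of
evaluation. The function may vary with the degree, because smoothings of the same degree will be
iterated and differentiation produces difference quotients that depend on `m`. -/
theorem tendstoContinuouslyOn_bernsteinCorner {q : ℕ → (Fin k → ℝ) → E} {q₀ : (Fin k → ℝ) → E}
    (h : TendstoContinuouslyOn q q₀ (cornerSimplex k)) :
    TendstoContinuouslyOn (fun m => bernsteinCorner m (q m)) q₀ (cornerSimplex k) := by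
  intro t ht
  obtain ⟨K, hK⟩ := h.exists_bound (isCompact_cornerSimplex k)
  have hK0 : 0 ≤ K := by
    obtain ⟨m, hm⟩ := hK.exists
    exact (norm_nonneg _).trans (hm t ht)
  set L : ℝ := K + ‖q₀ t‖ with hL
  have hL0 : 0 ≤ L := by positivity
  rw [Metric.tendsto_nhds]
  intro ε hε
  obtain ⟨pa, ha, pb, hb, hab⟩ := eventually_prod_iff.1
    (Metric.tendsto_nhds.1 (h t ht) (ε / 2) (half_pos hε))
  obtain ⟨δ, hδ, hδb⟩ := Metric.mem_nhdsWithin_iff.1 hb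
  have hlim : Tendsto (fun m : ℕ => L * (4 / δ ^ 2) * (k * (m : ℝ)⁻¹)) atTop (𝓝 0) := by
    simpa using (tendsto_inv_atTop_nhds_zero_nat (𝕜 := ℝ)).const_mul (k : ℝ) |>.const_mul
      (L * (4 / δ ^ 2))
  have hev := hlim.eventually (gt_mem_nhds (half_pos hε))
  refine eventually_prod_iff.2 ⟨fun m => pa m ∧ (∀ u ∈ cornerSimplex k, ‖q m u‖ ≤ K) ∧
    L * (4 / δ ^ 2) * (k * (m : ℝ)⁻¹) < ε / 2 ∧ 0 < m,
    ha.and (hK.and (hev.and (eventually_gt_atTop 0))),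
    fun x => x ∈ cornerSimplex k ∧ dist x t < δ / 2, ?_, ?_⟩
  · filter_upwards [self_mem_nhdsWithin,
      mem_nhdsWithin_of_mem_nhds (Metric.ball_mem_nhds t (half_pos hδ))] with x hx hx'
    exact ⟨hx, hx'⟩
  rintro m ⟨hm1, hm2, hm3, hm0⟩ x ⟨hx, hxt⟩
  have hm0' : (0 : ℝ) < m := by exact_mod_cast hm0
  -- Chebyshev's inequality in pointwise form: `ε / 2` takes care of the nodes near `t`. A node at
  -- distance at least `δ` from `t` is at distance at least `δ / 2` from `x`, so there the quadratic
  -- term exceeds the trivial bound `L`.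
  have hpt : ∀ z : Fin k → ℝ, (∀ i, 0 ≤ z i) → ∑ i, z i ≤ 0 + (m : ℝ) →
      ‖q m ((m : ℝ)⁻¹ • z) - q₀ t‖ ≤
        ε / 2 + (L * (4 / δ ^ 2) * (m : ℝ)⁻¹ ^ 2) • ∑ j, (z j - m * x j) ^ 2 := by
    intro z hz hzm
    have hu := inv_smul_mem_cornerSimplex (m := m) hz (by simpa using hzm)
    set u := (m : ℝ)⁻¹ • z with hudef
    have hsq : 0 ≤ ∑ j, (z j - m * x j) ^ 2 := Finset.sum_nonneg fun j _ => sq_nonneg _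
    by_cases hut : dist u t < δ
    · have := hab hm1 (hδb ⟨hut, hu⟩)
      rw [dist_eq_norm] at this
      have : 0 ≤ (L * (4 / δ ^ 2) * (m : ℝ)⁻¹ ^ 2) • ∑ j, (z j - m * x j) ^ 2 := by
        rw [smul_eq_mul]; positivity
      linarith
    · have h1 : δ / 2 ≤ ‖u - x‖ := by
        have := dist_triangle u x t
        rw [← dist_eq_norm]; linarith
      have h2 : ‖u - x‖ ^ 2 ≤ (m : ℝ)⁻¹ ^ 2 * ∑ j, (z j - m * x j) ^ 2 := by
        have hr : ‖u - x‖ ≤ √((m : ℝ)⁻¹ ^ 2 * ∑ j, (z j - m * x j) ^ 2) := by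
          refine (pi_norm_le_iff_of_nonneg (Real.sqrt_nonneg _)).2 fun j => ?_
          rw [Real.norm_eq_abs]
          apply Real.abs_le_sqrt
          have e : (u - x) j = (m : ℝ)⁻¹ * (z j - m * x j) := by
            simp only [hudef, Pi.sub_apply, Pi.smul_apply, smul_eq_mul]
            field_simp
          rw [e, mul_pow]
          exact mul_le_mul_of_nonneg_left (Finset.single_le_sum (f := fun j => (z j - m * x j) ^ 2)
            (fun j _ => sq_nonneg _) (Finset.mem_univ j)) (by positivity)
        calc ‖u - x‖ ^ 2 ≤ √((m : ℝ)⁻¹ ^ 2 * ∑ j, (z j - m * x j) ^ 2) ^ 2 := by gcongr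
          _ = _ := Real.sq_sqrt (by positivity)
      have h3 : 1 ≤ 4 / δ ^ 2 * ‖u - x‖ ^ 2 := by
        have : (δ / 2) ^ 2 ≤ ‖u - x‖ ^ 2 := by gcongr
        rw [div_mul_eq_mul_div, le_div_iff₀ (by positivity)]
        nlinarith
      calc ‖q m u - q₀ t‖ ≤ L * 1 := by
            rw [mul_one]; exact (norm_sub_le _ _).trans (by linarith [hm2 u hu])
        _ ≤ L * (4 / δ ^ 2 * ((m : ℝ)⁻¹ ^ 2 * ∑ j, (z j - m * x j) ^ 2)) := by
            refine mul_le_mul_of_nonneg_left (h3.trans ?_) hL0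
            gcongr
        _ ≤ _ := by rw [smul_eq_mul]; linarith
  have hmain := norm_walkAverage_le hx m (r := 0) (y := 0) (by simp) (by simp) hpt
  rw [walkAverage_sub, walkAverage_const, walkAverage_add, walkAverage_const, walkAverage_smul,
    walkAverage_sum] at hmain
  simp only [walkAverage_sq] at hmain
  rw [dist_eq_norm]
  refine hmain.trans_lt ?_
  have hvar : ∑ j, (((0 : Fin k → ℝ) j + m * x j - m * x j) ^ 2 + m * (x j * (1 - x j))) ≤
      (m : ℝ) * k := by
    calc _ ≤ ∑ _j : Fin k, (m : ℝ) := by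
          refine Finset.sum_le_sum fun j _ => ?_
          have h0 := hx.1 j
          have h1 : x j ≤ 1 := (cornerSimplex_subset_Icc k hx).2 j
          have h2 : x j * (1 - x j) ≤ 1 := by nlinarith
          have h3 : (m : ℝ) * (x j * (1 - x j)) ≤ m * 1 := mul_le_mul_of_nonneg_left h2 hm0'.le
          simpa using h3
      _ = m * k := by simp [mul_comm]
  have : (L * (4 / δ ^ 2) * (m : ℝ)⁻¹ ^ 2) •
      ∑ j, (((0 : Fin k → ℝ) j + m * x j - m * x j) ^ 2 + m * (x j * (1 - x j))) ≤
      L * (4 / δ ^ 2) * (k * (m : ℝ)⁻¹) := by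
    rw [smul_eq_mul]
    refine (mul_le_mul_of_nonneg_left hvar (by positivity)).trans (le_of_eq ?_)
    field_simp
  linarith

/-- The derivative in degree `m + 1` is again a Bernstein polynomial, of degree `m`, of difference
quotients with mesh `1 / (m + 1)`. The nodes are rescaled from `z / (m + 1)` to `x = z / m`, which
accounts for the factor `m` in front of `x`. -/
theorem fderiv_bernsteinCorner_single (m : ℕ) (g : (Fin k → ℝ) → E) (t : Fin k → ℝ) (i : Fin k) :
    fderiv ℝ (bernsteinCorner (m + 1) g) t (Pi.single i 1) =
      bernsteinCorner m (fun x => (m + 1 : ℝ) •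
        (g ((m + 1 : ℝ)⁻¹ • ((m : ℝ) • x + Pi.single i 1)) - g ((m + 1 : ℝ)⁻¹ • (m : ℝ) • x))) t := by
  have h := fderiv_walkAverage_single m t (fun z => g (((m + 1 : ℕ) : ℝ)⁻¹ • z)) 0 i
  unfold bernsteinCorner
  rw [h, ← walkAverage_smul]
  push_cast
  rcases Nat.eq_zero_or_pos m with rfl | hm
  · simp [walkAverage]
  · have hm' : (m : ℝ) ≠ 0 := by positivity
    congr 1
    ext z
    rw [smul_inv_smul₀ hm']

/-- The difference quotients converge continuously to the partial derivatives of `g₀`, by the mean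
value inequality. Continuous convergence of Bernstein polynomials is then applied to them. -/
theorem tendstoContinuouslyOn_fderivWithin_bernsteinCorner {g : ℕ → (Fin k → ℝ) → E}
    {g₀ : (Fin k → ℝ) → E}
    (hg : ∀ᶠ m in atTop, DifferentiableOn ℝ (g m) (cornerSimplex k))
    (h : TendstoContinuouslyOn (fun m => fderivWithin ℝ (g m) (cornerSimplex k))
      (fderivWithin ℝ g₀ (cornerSimplex k)) (cornerSimplex k)) :
    TendstoContinuouslyOn
      (fun m => fderivWithin ℝ (bernsteinCorner m (g m)) (cornerSimplex k))
      (fderivWithin ℝ g₀ (cornerSimplex k)) (cornerSimplex k) := by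
  have hdir : ∀ i, TendstoContinuouslyOn (fun m x => (m + 1 : ℝ) •
        (g (m + 1) ((m + 1 : ℝ)⁻¹ • ((m : ℝ) • x + Pi.single i 1)) -
          g (m + 1) ((m + 1 : ℝ)⁻¹ • (m : ℝ) • x)))
      (fun t => fderivWithin ℝ g₀ (cornerSimplex k) t (Pi.single i 1)) (cornerSimplex k) := by
    intro i t ht
    rw [Metric.tendsto_nhds]
    intro ε hε
    obtain ⟨pa, ha, pb, hb, hab⟩ := eventually_prod_iff.1
      (Metric.tendsto_nhds.1 (h t ht) (ε / 2) (half_pos hε))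
    obtain ⟨δ, hδ, hδb⟩ := Metric.mem_nhdsWithin_iff.1 hb
    have hlim : Tendsto (fun m : ℕ => 1 / ((m : ℝ) + 1)) atTop (𝓝 0) :=
      tendsto_one_div_add_atTop_nhds_zero_nat
    refine eventually_prod_iff.2 ⟨fun m => pa (m + 1) ∧
      DifferentiableOn ℝ (g (m + 1)) (cornerSimplex k) ∧ 1 / ((m : ℝ) + 1) < δ / 2,
      ((tendsto_add_atTop_nat 1).eventually ha).and
        (((tendsto_add_atTop_nat 1).eventually hg).and
          (hlim.eventually (gt_mem_nhds (half_pos hδ)))),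
      fun x => x ∈ cornerSimplex k ∧ dist x t < δ / 2, ?_, ?_⟩
    · filter_upwards [self_mem_nhdsWithin,
        mem_nhdsWithin_of_mem_nhds (Metric.ball_mem_nhds t (half_pos hδ))] with x hx hx'
      exact ⟨hx, hx'⟩
    rintro m ⟨hm1, hm2, hm3⟩ x ⟨hx, hxt⟩
    have hm0 : (0 : ℝ) < m + 1 := by positivity
    set a := (m + 1 : ℝ)⁻¹ • (m : ℝ) • x with hadef
    set b := (m + 1 : ℝ)⁻¹ • ((m : ℝ) • x + Pi.single i 1) with hbdef
    have hsum : ∑ j, (m : ℝ) * x j ≤ m := by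
      rw [← Finset.mul_sum]; exact mul_le_of_le_one_right (by positivity) hx.2
    have hmem : ∀ z : Fin k → ℝ, (∀ j, 0 ≤ z j) → ∑ j, z j ≤ m + 1 →
        (m + 1 : ℝ)⁻¹ • z ∈ cornerSimplex k := fun z hz hzm => by
      simpa using inv_smul_mem_cornerSimplex (m := m + 1) hz (by simpa using hzm)
    have hac : a ∈ cornerSimplex k := hmem _ (fun j => mul_nonneg (by positivity) (hx.1 j))
      (by simp only [Pi.smul_apply, smul_eq_mul]; linarith)
    have hbc : b ∈ cornerSimplex k := by
      refine hmem _ (fun j => ?_) ?_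
      · have : (0 : ℝ) ≤ (Pi.single i (1 : ℝ) : Fin k → ℝ) j := by
          by_cases hij : j = i <;> simp [hij]
        exact add_nonneg (mul_nonneg (by positivity) (hx.1 j)) this
      · simp [Finset.sum_add_distrib]; linarith
    have hxle : ‖x‖ ≤ 1 := (pi_norm_le_iff_of_nonneg zero_le_one).2 fun j => by
      rw [Real.norm_of_nonneg (hx.1 j)]; exact (cornerSimplex_subset_Icc k hx).2 j
    have hax : dist a x ≤ 1 / ((m : ℝ) + 1) := by
      have : a - x = -((m + 1 : ℝ)⁻¹ • x) := by
        rw [hadef, smul_smul, ← sub_eq_zero]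
        have : (m + 1 : ℝ)⁻¹ * m + (m + 1 : ℝ)⁻¹ = 1 := by field_simp
        calc _ = ((m + 1 : ℝ)⁻¹ * m + (m + 1 : ℝ)⁻¹ - 1) • x := by module
          _ = 0 := by rw [this]; simp
      rw [dist_eq_norm, this, norm_neg, norm_smul, Real.norm_of_nonneg (by positivity), one_div]
      exact mul_le_of_le_one_right (by positivity) hxle
    have hbx : dist b x ≤ 1 / ((m : ℝ) + 1) := by
      have : b - x = (m + 1 : ℝ)⁻¹ • (Pi.single i 1 - x) := by
        rw [hbdef, ← sub_eq_zero]
        have : (m + 1 : ℝ)⁻¹ * m + (m + 1 : ℝ)⁻¹ = 1 := by field_simp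
        calc _ = ((m + 1 : ℝ)⁻¹ * m + (m + 1 : ℝ)⁻¹ - 1) • x := by module
          _ = 0 := by rw [this]; simp
      rw [dist_eq_norm, this, norm_smul, Real.norm_of_nonneg (by positivity), one_div]
      refine mul_le_of_le_one_right (by positivity) ?_
      refine (pi_norm_le_iff_of_nonneg zero_le_one).2 fun j => ?_
      have h0 := hx.1 j
      have h1 : x j ≤ 1 := (cornerSimplex_subset_Icc k hx).2 j
      rw [Real.norm_eq_abs, abs_le, Pi.sub_apply]
      by_cases hij : j = i
      · subst hij; simp; constructor <;> linarith
      · simp [hij]; constructor <;> linarith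
    have hat : a ∈ cornerSimplex k ∩ Metric.ball t δ :=
      ⟨hac, by have := dist_triangle a x t; rw [Metric.mem_ball]; linarith⟩
    have hbt : b ∈ cornerSimplex k ∩ Metric.ball t δ :=
      ⟨hbc, by have := dist_triangle b x t; rw [Metric.mem_ball]; linarith⟩
    have hconv : Convex ℝ (cornerSimplex k ∩ Metric.ball t δ) :=
      (convex_cornerSimplex k).inter (convex_ball t δ)
    -- Both nodes `a` and `b` lie in the convex set where the derivative of `g (m + 1)` is within `ε
    -- / 2` of the fixed linear map `φ`.
    have hmv := Convex.norm_image_sub_le_of_norm_hasFDerivWithin_le' (C := ε / 2)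
      (f := g (m + 1)) (f' := fun x => fderivWithin ℝ (g (m + 1)) (cornerSimplex k) x)
      (φ := fderivWithin ℝ g₀ (cornerSimplex k) t)
      (fun y hy => (hm2 y hy.1).hasFDerivWithinAt.mono inter_subset_left)
      (fun y hy => by
        have := hab hm1 (hδb ⟨hy.2, hy.1⟩)
        rw [dist_eq_norm] at this
        exact this.le) hconv hat hbt
    have hba : b - a = (m + 1 : ℝ)⁻¹ • Pi.single i 1 := by rw [hbdef, hadef]; module
    rw [hba, map_smul, norm_smul, Real.norm_of_nonneg (by positivity : (0 : ℝ) ≤ (m + 1 : ℝ)⁻¹)]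
      at hmv
    rw [dist_eq_norm]
    have : (m + 1 : ℝ) • (g (m + 1) b - g (m + 1) a) -
        fderivWithin ℝ g₀ (cornerSimplex k) t (Pi.single i 1) =
        (m + 1 : ℝ) • (g (m + 1) b - g (m + 1) a -
          (m + 1 : ℝ)⁻¹ • fderivWithin ℝ g₀ (cornerSimplex k) t (Pi.single i 1)) := by
      rw [smul_sub _ (g (m + 1) b - g (m + 1) a), smul_inv_smul₀ hm0.ne']
    rw [this, norm_smul, Real.norm_of_nonneg hm0.le]
    have hsingle : ‖(Pi.single i 1 : Fin k → ℝ)‖ ≤ 1 := by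
      refine (pi_norm_le_iff_of_nonneg zero_le_one).2 fun j => ?_
      by_cases hij : j = i <;> simp [hij]
    calc _ ≤ (m + 1 : ℝ) * (ε / 2 * ((m + 1 : ℝ)⁻¹ * ‖(Pi.single i 1 : Fin k → ℝ)‖)) := by gcongr
      _ = ε / 2 * ‖(Pi.single i 1 : Fin k → ℝ)‖ := by field_simp
      _ ≤ ε / 2 * 1 := by gcongr
      _ < ε := by linarith
  intro t ht
  -- The derivative formula concerns the degree `m + 1`; the shift of the index is undone at the
  -- end.
  have hshift : Tendsto (fun q : ℕ × (Fin k → ℝ) =>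
      fderivWithin ℝ (bernsteinCorner (q.1 + 1) (g (q.1 + 1))) (cornerSimplex k) q.2)
      (atTop ×ˢ 𝓝[cornerSimplex k] t) (𝓝 (fderivWithin ℝ g₀ (cornerSimplex k) t)) := by
    have hfd : ∀ L : (Fin k → ℝ) →L[ℝ] E, L = ∑ i, (ContinuousLinearMap.proj (R := ℝ)
        (φ := fun _ : Fin k => ℝ) i).smulRight (L (Pi.single i 1)) := by
      intro L
      ext v
      conv_lhs => rw [pi_eq_sum_univ' v, map_sum]
      simp only [map_smul, sum_apply, ContinuousLinearMap.smulRight_apply,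
        ContinuousLinearMap.proj_apply]
    rw [hfd (fderivWithin ℝ g₀ (cornerSimplex k) t)]
    refine Tendsto.congr' (f₁ := fun q : ℕ × (Fin k → ℝ) =>
      ∑ i, (ContinuousLinearMap.proj (R := ℝ) (φ := fun _ : Fin k => ℝ) i).smulRight
        (bernsteinCorner q.1 (fun x => (q.1 + 1 : ℝ) •
        (g (q.1 + 1) ((q.1 + 1 : ℝ)⁻¹ • ((q.1 : ℝ) • x + Pi.single i 1)) -
          g (q.1 + 1) ((q.1 + 1 : ℝ)⁻¹ • (q.1 : ℝ) • x))) q.2)) ?_ ?_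
    · have hmem : ∀ᶠ q : ℕ × (Fin k → ℝ) in atTop ×ˢ 𝓝[cornerSimplex k] t,
          q.2 ∈ cornerSimplex k := tendsto_snd.eventually self_mem_nhdsWithin
      filter_upwards [hmem] with q hq
      rw [((contDiff_bernsteinCorner (q.1 + 1) (g (q.1 + 1)) (r := 1)).differentiable (by simp)
        q.2).fderivWithin (uniqueDiffOn_cornerSimplex k q.2 hq),
        hfd (fderiv ℝ (bernsteinCorner (q.1 + 1) (g (q.1 + 1))) q.2)]
      simp only [fderiv_bernsteinCorner_single]
    · refine tendsto_finsetSum _ fun i _ => ?_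
      have := tendstoContinuouslyOn_bernsteinCorner (hdir i) t ht
      exact ((ContinuousLinearMap.smulRightL ℝ (Fin k → ℝ) E
        (ContinuousLinearMap.proj (R := ℝ) (φ := fun _ : Fin k => ℝ) i)).continuous.tendsto _).comp
        this
  have hsub : Tendsto (fun q : ℕ × (Fin k → ℝ) => (q.1 - 1, q.2)) (atTop ×ˢ 𝓝[cornerSimplex k] t)
      (atTop ×ˢ 𝓝[cornerSimplex k] t) :=
    ((tendsto_sub_atTop_nat 1).comp tendsto_fst).prodMk tendsto_snd
  refine (hshift.comp hsub).congr' ?_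
  filter_upwards [tendsto_fst.eventually (eventually_ge_atTop 1)] with q hq
  simp only [Function.comp_apply, Nat.sub_add_cancel hq]

end Bernstein

/-! ### Faces of the corner simplex -/

section Faces

variable {k : ℕ}

/-- The linear part of the `i`-th face map of the corner simplex. -/
def cornerFaceLinear (i : Fin (k + 2)) : (Fin k → ℝ) →L[ℝ] (Fin (k + 1) → ℝ) :=
  i.cases (ContinuousLinearMap.pi (Fin.cons (-∑ j, ContinuousLinearMap.proj j)
      fun j => ContinuousLinearMap.proj j))
    fun i => ContinuousLinearMap.pi (i.insertNth 0 fun j => ContinuousLinearMap.proj j)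

/-- The image of the vertex `0` under the `i`-th face map of the corner simplex. -/
def cornerFaceVertex (i : Fin (k + 2)) : Fin (k + 1) → ℝ :=
  i.cases (Pi.single 0 1) fun _ => 0

/-- The `i`-th face map of the corner simplex. -/
def cornerFace (i : Fin (k + 2)) (t : Fin k → ℝ) : Fin (k + 1) → ℝ :=
  cornerFaceLinear i t + cornerFaceVertex i

theorem cornerFace_zero (t : Fin k → ℝ) :
    cornerFace 0 t = (0 : Fin (k + 1)).insertNth (1 - ∑ i, t i) t := by
  ext j
  refine j.cases ?_ fun j => ?_
  · simp [cornerFace, cornerFaceLinear, cornerFaceVertex]; ring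
  · simp [cornerFace, cornerFaceLinear, cornerFaceVertex]

theorem cornerFace_succ (i : Fin (k + 1)) (t : Fin k → ℝ) :
    cornerFace i.succ t = i.insertNth (0 : ℝ) t := by
  ext j
  refine i.succAboveCases ?_ (fun j => ?_) j <;>
  simp [cornerFace, cornerFaceLinear, cornerFaceVertex]

theorem cornerFaceLinear_zero_single (j : Fin k) :
    cornerFaceLinear 0 (Pi.single j 1) = Pi.single j.succ 1 - Pi.single 0 1 := by
  ext l
  refine l.cases ?_ fun l => ?_
  · simp [cornerFaceLinear]
  · simp [cornerFaceLinear, Pi.single_apply]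

theorem cornerFaceLinear_succ_single (i : Fin (k + 1)) (j : Fin k) :
    cornerFaceLinear i.succ (Pi.single j 1) = Pi.single (i.succAbove j) 1 := by
  ext l
  refine i.succAboveCases ?_ (fun l => ?_) l
  · simp [cornerFaceLinear, (Fin.succAbove_ne i j).symm]
  · simp [cornerFaceLinear, Pi.single_apply]

theorem insertNth_mem_cornerSimplex (i : Fin (k + 1)) (s : ℝ) (t : Fin k → ℝ) :
    (i.insertNth s t : Fin (k + 1) → ℝ) ∈ cornerSimplex (k + 1) ↔
      t ∈ cornerSimplex k ∧ s ∈ Icc 0 (1 - ∑ i, t i) := by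
  simp only [cornerSimplex, mem_ofPred_eq, i.forall_iff_succAbove, i.sum_univ_succAbove,
    Fin.insertNth_apply_same, Fin.insertNth_apply_succAbove, mem_Icc]
  constructor
  · rintro ⟨⟨h1, h2⟩, h3⟩; exact ⟨⟨h2, by linarith⟩, h1, by linarith⟩
  · rintro ⟨⟨h1, h2⟩, h3, h4⟩; exact ⟨⟨h3, h1⟩, by linarith⟩

theorem cornerFace_mem (i : Fin (k + 2)) {t : Fin k → ℝ} (ht : t ∈ cornerSimplex k) :
    cornerFace i t ∈ cornerSimplex (k + 1) := by
  have h := sub_nonneg.2 ht.2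
  refine i.cases ?_ fun i => ?_
  · rw [cornerFace_zero, insertNth_mem_cornerSimplex]
    exact ⟨ht, h, le_rfl⟩
  · rw [cornerFace_succ, insertNth_mem_cornerSimplex]
    exact ⟨ht, le_rfl, h⟩

theorem hasFDerivAt_cornerFace (i : Fin (k + 2)) (t : Fin k → ℝ) :
    HasFDerivAt (cornerFace i) (cornerFaceLinear i) t :=
  (cornerFaceLinear i).hasFDerivAt.add_const _

theorem contDiff_cornerFace (i : Fin (k + 2)) {r : WithTop ℕ∞} :
    ContDiff ℝ r (cornerFace (k := k) i) :=
  (cornerFaceLinear i).contDiff.add contDiff_const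

/-- For a parameter on a face the step towards the opposite vertex has probability `0`, so the walk
is one on the face, carried along by `cornerFaceVertex` at each step. In degree `0` the polynomial
is the value at the vertex `0`, which face `0` does not contain; hence `m ≠ 0`. -/
theorem bernsteinCorner_cornerFace {E : Type*} [NormedAddCommGroup E] [NormedSpace ℝ E] {m : ℕ}
    (hm : m ≠ 0) (i : Fin (k + 2)) (g : (Fin (k + 1) → ℝ) → E) (t : Fin k → ℝ) :
    bernsteinCorner m g (cornerFace i t) = bernsteinCorner m (fun z => g (cornerFace i z)) t := by
  have hstep : ∀ (F : (Fin (k + 1) → ℝ) → E) y, walkStep (cornerFace i t) F y =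
      (1 - ∑ j, t j) • F (y + cornerFaceVertex i) +
        ∑ j, t j • F (y + cornerFaceVertex i + cornerFaceLinear i (Pi.single j 1)) := by
    intro F y
    refine i.cases ?_ fun i => ?_
    · simp only [cornerFace_zero, walkStep, cornerFaceLinear_zero_single, Fin.sum_univ_succ,
        Fin.insertNth_zero, Fin.cons_zero, Fin.cons_succ]
      simp [cornerFaceVertex]
    · simp only [cornerFace_succ, walkStep, cornerFaceLinear_succ_single, i.sum_univ_succAbove,
        Fin.insertNth_apply_same, Fin.insertNth_apply_succAbove]
      simp [cornerFaceVertex]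
  -- The offset `c` keeps track of the drift `m • cornerFaceVertex i` during the induction.
  have hwalk : ∀ (m : ℕ) (G : (Fin (k + 1) → ℝ) → E) y c,
      walkAverage m (cornerFace i t) G (cornerFaceLinear i y + c) =
        walkAverage m t (fun z => G (cornerFaceLinear i z + (m : ℝ) • cornerFaceVertex i + c)) y := by
    intro m
    induction m with
    | zero => intro G y c; simp [walkAverage]
    | succ m ih =>
      intro G y c
      have h1 : walkAverage (m + 1) (cornerFace i t) G =
          walkStep (cornerFace i t) (walkAverage m (cornerFace i t) G) :=
        Function.iterate_succ_apply' _ _ _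
      rw [h1, hstep, walkAverage_succ, add_assoc _ c, ih]
      have h2 : ∀ z, cornerFaceLinear i z + (m : ℝ) • cornerFaceVertex i +
          (c + cornerFaceVertex i) = cornerFaceLinear i z +
            ((m + 1 : ℕ) : ℝ) • cornerFaceVertex i + c := fun z => by push_cast; module
      simp only [h2]
      congr 1
      refine Finset.sum_congr rfl fun j _ => ?_
      rw [add_right_comm, ← map_add, ih]
      simp only [h2]
  have := hwalk m (fun z => g ((m : ℝ)⁻¹ • z)) 0 0
  rw [map_zero, zero_add] at this
  rw [bernsteinCorner, bernsteinCorner, this]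
  congr 1
  ext z
  have hm' : (m : ℝ) ≠ 0 := by exact_mod_cast hm
  rw [add_zero, smul_add, inv_smul_smul₀ hm', cornerFace, map_smul]

end Faces

/-! ### Stokes' theorem on the corner simplex -/

section Stokes

variable {k : ℕ}

theorem setIntegral_cornerSimplex_succ (i : Fin (k + 1)) {h : (Fin (k + 1) → ℝ) → ℝ}
    (hh : IntegrableOn h (cornerSimplex (k + 1))) :
    ∫ t in cornerSimplex (k + 1), h t =
      ∫ t in cornerSimplex k, ∫ s in Icc 0 (1 - ∑ j, t j), h (i.insertNth s t) := by
  have hmeas := (isClosed_cornerSimplex (k + 1)).measurableSet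
  have hmp := (volume_preserving_piFinSuccAbove (fun _ : Fin (k + 1) => ℝ) i).symm
  have hind := (integrable_indicator_iff hmeas).2 hh
  rw [← integral_indicator hmeas, ← hmp.integral_comp' , Measure.volume_eq_prod,
    integral_prod_symm _ (by
      rw [← Measure.volume_eq_prod]
      exact (hmp.integrable_comp_emb (MeasurableEquiv.measurableEmbedding _)).2 hind),
    ← integral_indicator (isClosed_cornerSimplex k).measurableSet]
  congr 1
  ext t
  by_cases ht : t ∈ cornerSimplex k
  · rw [indicator_of_mem ht, ← integral_indicator measurableSet_Icc]
    congr 1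
    ext s
    have : ((MeasurableEquiv.piFinSuccAbove (fun _ => ℝ) i).symm (s, t) : Fin (k + 1) → ℝ) =
      i.insertNth s t := rfl
    rw [this]
    by_cases hs : s ∈ Icc 0 (1 - ∑ j, t j)
    · rw [indicator_of_mem hs, indicator_of_mem ((insertNth_mem_cornerSimplex i s t).2 ⟨ht, hs⟩)]
    · rw [indicator_of_notMem hs, indicator_of_notMem fun h =>
        hs ((insertNth_mem_cornerSimplex i s t).1 h).2]
  · rw [indicator_of_notMem ht]
    refine (integral_congr_ae (ae_of_all _ fun s => ?_)).trans (integral_zero _ _)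
    exact indicator_of_notMem (fun h => ht ((insertNth_mem_cornerSimplex i s t).1 h).1) _

/-- The reflection of the corner simplex that exchanges the vertices `0` and `e_i`. -/
def cornerSwap (i : Fin k) (t : Fin k → ℝ) : Fin k → ℝ := Function.update t i (1 - ∑ j, t j)

theorem sum_cornerSwap (i : Fin k) (t : Fin k → ℝ) : 1 - ∑ j, cornerSwap i t j = t i := by
  rw [cornerSwap, Finset.sum_update_of_mem (Finset.mem_univ i),
    ← Finset.add_sum_erase _ _ (Finset.mem_univ i), Finset.sdiff_singleton_eq_erase]
  ring

theorem cornerSwap_cornerSwap (i : Fin k) (t : Fin k → ℝ) :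
    cornerSwap i (cornerSwap i t) = t := by
  rw [cornerSwap, sum_cornerSwap, cornerSwap, Function.update_idem, Function.update_eq_self]

theorem cornerSwap_mem (i : Fin k) {t : Fin k → ℝ} (ht : t ∈ cornerSimplex k) :
    cornerSwap i t ∈ cornerSimplex k := by
  refine ⟨fun j => ?_, ?_⟩
  · by_cases hj : j = i
    · subst hj; simpa [cornerSwap] using ht.2
    · simpa [cornerSwap, hj] using ht.1 j
  · have := sum_cornerSwap i t
    have := ht.1 i
    linarith

theorem continuous_cornerSwap (i : Fin k) : Continuous (cornerSwap i) := by
  unfold cornerSwap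
  fun_prop

/-- `cornerSwap` as a homeomorphism. -/
def cornerSwapHomeomorph (i : Fin k) : (Fin k → ℝ) ≃ₜ (Fin k → ℝ) where
  toFun := cornerSwap i
  invFun := cornerSwap i
  left_inv := cornerSwap_cornerSwap i
  right_inv := cornerSwap_cornerSwap i
  continuous_toFun := continuous_cornerSwap i
  continuous_invFun := continuous_cornerSwap i

/-- The linear part of an affine involution is an involution, so its determinant is `±1`. -/
theorem measurePreserving_cornerSwap (i : Fin k) : MeasurePreserving (cornerSwap i) := by
  let L : (Fin k → ℝ) →ₗ[ℝ] (Fin k → ℝ) := LinearMap.id +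
    (LinearMap.single ℝ (fun _ : Fin k => ℝ) i).comp
      (-(∑ j : Fin k, (LinearMap.proj j : (Fin k → ℝ) →ₗ[ℝ] ℝ)) - LinearMap.proj i)
  have hLt : ∀ t j, L t j = t j + (if j = i then -∑ l, t l - t i else 0) := by
    intro t j
    by_cases hj : j = i
    · subst hj; simp [L]
    · simp [L, hj]
  have hL : ∀ t, cornerSwap i t = L t + Pi.single i 1 := by
    intro t
    ext j
    rw [Pi.add_apply, hLt]
    by_cases hj : j = i
    · subst hj; simp [cornerSwap]; ring
    · simp [cornerSwap, hj]
  have hLL : L.comp L = LinearMap.id := by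
    apply LinearMap.ext
    intro t
    have h1 := cornerSwap_cornerSwap i t
    have h2 := cornerSwap_cornerSwap i (0 : Fin k → ℝ)
    simp only [hL, map_add, map_zero, zero_add] at h1 h2
    rw [add_assoc, h2, add_zero] at h1
    exact h1
  have hdet : LinearMap.det L * LinearMap.det L = 1 := by
    rw [← LinearMap.det_comp, hLL, LinearMap.det_id]
  have hdet0 : LinearMap.det L ≠ 0 := fun h => by simp [h] at hdet
  have habs : |(LinearMap.det L)⁻¹| = 1 := by
    rw [abs_inv, inv_eq_one]
    have := abs_mul_abs_self (LinearMap.det L)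
    rw [hdet] at this
    nlinarith [abs_nonneg (LinearMap.det L)]
  have hLmp : MeasurePreserving L := by
    refine ⟨L.continuous_of_finiteDimensional.measurable, ?_⟩
    rw [Real.map_linearMap_volume_pi_eq_smul_volume_pi hdet0, habs]
    simp
  have := (measurePreserving_add_right volume (Pi.single i (1 : ℝ) : Fin k → ℝ)).comp hLmp
  rwa [show cornerSwap i = (fun x => x + Pi.single i 1) ∘ L from funext hL]

/-- The slanted face is a graph over each coordinate hyperplane. The parametrisations that solve for
the coordinates `i` and `i + 1` differ by the measure-preserving `cornerSwap`, whence the induction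
on `i`. -/
theorem setIntegral_insertNth_sub_sum (i : Fin (k + 1)) (g : (Fin (k + 1) → ℝ) → ℝ) :
    ∫ t in cornerSimplex k, g (i.insertNth (1 - ∑ j, t j) t) =
      ∫ t in cornerSimplex k, g ((0 : Fin (k + 1)).insertNth (1 - ∑ j, t j) t) := by
  obtain ⟨i, hi⟩ := i
  induction i with
  | zero => rfl
  | succ i ih =>
    have hik : i < k := by omega
    rw [← ih (by omega), ← (measurePreserving_cornerSwap ⟨i, hik⟩).setIntegral_preimage_emb
      (cornerSwapHomeomorph ⟨i, hik⟩).measurableEmbedding]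
    have hpre : cornerSwap ⟨i, hik⟩ ⁻¹' cornerSimplex k = cornerSimplex k := by
      ext t
      refine ⟨fun h => ?_, fun h => cornerSwap_mem _ h⟩
      have := cornerSwap_mem ⟨i, hik⟩ h
      rwa [cornerSwap_cornerSwap] at this
    rw [hpre]
    congr 1
    ext t
    rw [sum_cornerSwap]
    congr 1
    ext j
    rcases lt_trichotomy j.1 i with hj | hj | hj
    · have e1 : j = Fin.succAbove ⟨i + 1, hi⟩ ⟨j.1, by omega⟩ := by
        rw [Fin.succAbove_of_castSucc_lt _ _ (by simp [Fin.lt_def]; omega)]; rfl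
      have e2 : j = Fin.succAbove ⟨i, by omega⟩ ⟨j.1, by omega⟩ := by
        rw [Fin.succAbove_of_castSucc_lt _ _ (by simp [Fin.lt_def]; omega)]; rfl
      conv_lhs => rw [e1]
      conv_rhs => rw [e2]
      rw [Fin.insertNth_apply_succAbove, Fin.insertNth_apply_succAbove, cornerSwap,
        Function.update_of_ne (by simp [Fin.ext_iff]; omega)]
    · have e1 : j = Fin.succAbove ⟨i + 1, hi⟩ ⟨i, hik⟩ := by
        rw [Fin.succAbove_of_castSucc_lt _ _ (by simp [Fin.lt_def])]; ext; simp [hj]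
      have e2 : j = ⟨i, by omega⟩ := by ext; simp [hj]
      conv_lhs => rw [e1]
      conv_rhs => rw [e2]
      rw [Fin.insertNth_apply_succAbove, Fin.insertNth_apply_same]
      simp [cornerSwap]
    · have e2 : j = Fin.succAbove ⟨i, by omega⟩ ⟨j.1 - 1, by omega⟩ := by
        rw [Fin.succAbove_of_le_castSucc _ _ (by simp [Fin.le_def]; omega)]
        ext; simp; omega
      rcases eq_or_ne j.1 (i + 1) with hj' | hj'
      · have e1 : j = ⟨i + 1, hi⟩ := by ext; simp [hj']
        conv_rhs => rw [e2]
        conv_lhs => rw [e1]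
        rw [Fin.insertNth_apply_same, Fin.insertNth_apply_succAbove]
        have : (⟨j.1 - 1, by omega⟩ : Fin k) = ⟨i, hik⟩ := by ext; simp; omega
        rw [this]
      · have e1 : j = Fin.succAbove ⟨i + 1, hi⟩ ⟨j.1 - 1, by omega⟩ := by
          rw [Fin.succAbove_of_le_castSucc _ _ (by simp [Fin.le_def]; omega)]
          ext; simp; omega
        conv_lhs => rw [e1]
        conv_rhs => rw [e2]
        rw [Fin.insertNth_apply_succAbove, Fin.insertNth_apply_succAbove, cornerSwap,
          Function.update_of_ne (by simp [Fin.ext_iff]; omega)]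

theorem ContinuousAlternatingMap.map_cons_sub {E : Type*} [NormedAddCommGroup E]
    [NormedSpace ℝ E] (Φ : E [⋀^Fin (k + 1)]→L[ℝ] ℝ) (u : E) (w : Fin k → E) :
    Φ (Fin.cons u fun j => w j - u) = Φ (Fin.cons u w) := by
  classical
  suffices ∀ s : Finset (Fin k), Φ (Fin.cons u fun j => if j ∈ s then w j - u else w j) =
      Φ (Fin.cons u w) by simpa using this Finset.univ
  intro s
  induction s using Finset.induction_on with
  | empty => simp
  | insert a s ha ih =>
    rw [← ih]
    set v : Fin (k + 1) → E := Fin.cons u fun j => if j ∈ s then w j - u else w j with hv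
    have e : (Fin.cons u fun j => if j ∈ insert a s then w j - u else w j : Fin (k + 1) → E) =
        Function.update v a.succ (v a.succ - v 0) := by
      ext j
      refine j.cases ?_ fun j => ?_
      · rw [Function.update_of_ne (Fin.succ_ne_zero a).symm]; simp [hv]
      · by_cases hj : j = a
        · subst hj; simp [hv, ha]
        · rw [Function.update_of_ne (by simpa using hj)]; simp [hv, hj]
    rw [e, Φ.map_update_sub, Function.update_eq_self,
      sub_eq_self]
    exact Φ.toAlternatingMap.map_update_self _ (Fin.succ_ne_zero a)

/-- This expands the tangent `k`-vector of the slanted face in coordinate `k`-vectors. Let `ℓ` be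
the sum of the coordinates, so that `ℓ (e_j) = 1` and `ℓ` kills all differences. Subtracting `e_0`
from the other arguments does not change `ℓ ∧ φ` on the standard frame; expanding both sides gives
the identity. -/
theorem ContinuousAlternatingMap.map_sub_single_zero
    (φ : (Fin (k + 1) → ℝ) [⋀^Fin k]→L[ℝ] ℝ) :
    φ (fun j => Pi.single j.succ 1 - Pi.single 0 1) =
      ∑ i : Fin (k + 1), (-1) ^ i.val * φ (i.removeNth fun j => (Pi.single j 1 : Fin (k + 1) → ℝ)) := by
  let ℓ : (Fin (k + 1) → ℝ) →L[ℝ] ℝ := ∑ j, ContinuousLinearMap.proj j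
  have hℓ : ∀ j, ℓ (Pi.single j 1) = 1 := fun j => by simp [ℓ, Pi.single_apply]
  let Φ := ContinuousAlternatingMap.alternatizeUncurryFin (ℓ.smulRight φ)
  have h1 := Φ.map_cons_sub (Pi.single 0 1) (fun j : Fin k => Pi.single j.succ 1)
  have h2 : (Fin.cons (Pi.single 0 1) fun j : Fin k => Pi.single j.succ 1 :
      Fin (k + 1) → Fin (k + 1) → ℝ) = fun j => Pi.single j 1 := by
    funext j
    exact j.cases rfl fun j => rfl
  rw [h2, ContinuousAlternatingMap.alternatizeUncurryFin_apply,
    ContinuousAlternatingMap.alternatizeUncurryFin_apply, Fin.sum_univ_succ] at h1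
  simpa [hℓ] using h1

/-- Stokes' theorem for closed forms on the corner simplex. -/
theorem sum_setIntegral_cornerFace_eq_zero
    {η : (Fin (k + 1) → ℝ) → (Fin (k + 1) → ℝ) [⋀^Fin k]→L[ℝ] ℝ}
    (hη : DifferentiableOn ℝ η (cornerSimplex (k + 1)))
    (hη' : ∀ v, ContDiffOn ℝ 1 (fun t => η t v) (cornerSimplex (k + 1)))
    (hd : ∀ t ∈ cornerSimplex (k + 1), extDerivWithin η (cornerSimplex (k + 1)) t = 0) :
    ∑ i : Fin (k + 2), (-1) ^ i.val * ∫ t in cornerSimplex k,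
      η (cornerFace i t) (fun j => cornerFaceLinear i (Pi.single j 1)) = 0 := by
  set e : Fin (k + 1) → Fin (k + 1) → ℝ := fun j => Pi.single j 1 with he
  set f : Fin (k + 1) → (Fin (k + 1) → ℝ) → ℝ := fun i t => η t (i.removeNth e) with hf
  have hfd : ∀ i, ContDiffOn ℝ 1 (f i) (cornerSimplex (k + 1)) := fun i =>
    hη' (i.removeNth e)
  set df : Fin (k + 1) → (Fin (k + 1) → ℝ) → ℝ := fun i t =>
    fderivWithin ℝ (f i) (cornerSimplex (k + 1)) t (e i) with hdf
  have hdfc : ∀ i, ContinuousOn (df i) (cornerSimplex (k + 1)) := fun i =>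
    ((hfd i).continuousOn_fderivWithin (uniqueDiffOn_cornerSimplex _) le_rfl).clm_apply
      continuousOn_const
  have hdfi : ∀ i, IntegrableOn (df i) (cornerSimplex (k + 1)) := fun i =>
    (hdfc i).integrableOn_compact (isCompact_cornerSimplex _)
  have hface : ∀ i : Fin (k + 2), ContinuousOn (fun t => cornerFace i t) (cornerSimplex k) :=
    fun i => (contDiff_cornerFace i (r := 0)).continuous.continuousOn
  -- Fubini in direction `e_i` and the fundamental theorem of calculus on each segment. The upper
  -- ends fill the slanted face, which is then reparametrised as face `0`.
  have hFTC : ∀ i, ∫ t in cornerSimplex (k + 1), df i t =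
      (∫ t in cornerSimplex k, f i (cornerFace 0 t)) -
        ∫ t in cornerSimplex k, f i (cornerFace i.succ t) := by
    intro i
    have h1 : ∀ t ∈ cornerSimplex k, ∫ s in Icc 0 (1 - ∑ j, t j), df i (i.insertNth s t) =
        f i (i.insertNth (1 - ∑ j, t j) t) - f i (i.insertNth 0 t) := by
      intro t ht
      have ht' := sub_nonneg.2 ht.2
      have hmaps : MapsTo (fun s => (i.insertNth s t : Fin (k + 1) → ℝ)) (Icc 0 (1 - ∑ j, t j))
        (cornerSimplex (k + 1)) := fun s hs => (insertNth_mem_cornerSimplex i s t).2 ⟨ht, hs⟩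
      have hline : ∀ s, HasDerivAt (fun s => (i.insertNth s t : Fin (k + 1) → ℝ)) (e i) s := by
        intro s
        rw [hasDerivAt_pi]
        intro j
        refine i.succAboveCases ?_ (fun j => ?_) j
        · simpa [he] using hasDerivAt_id' s
        · simpa [he] using hasDerivAt_const s (t j)
      have hcont : Continuous (fun s => (i.insertNth s t : Fin (k + 1) → ℝ)) :=
        continuous_iff_continuousAt.2 fun s => (hline s).continuousAt
      rw [integral_Icc_eq_integral_Ioc, ← intervalIntegral.integral_of_le ht']
      refine intervalIntegral.integral_eq_sub_of_hasDerivAt_of_le ht'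
        ((hfd i).continuousOn.comp hcont.continuousOn hmaps) (fun s hs => ?_) ?_
      · have hs' := hmaps (Ioo_subset_Icc_self hs)
        have := (((hfd i).differentiableOn (by simp) _ hs').hasFDerivWithinAt.comp_hasDerivWithinAt
          s (hline s).hasDerivWithinAt hmaps)
        exact this.hasDerivAt (Icc_mem_nhds hs.1 hs.2)
      · refine ContinuousOn.intervalIntegrable ?_
        rw [uIcc_of_le ht']
        exact (hdfc i).comp hcont.continuousOn hmaps
    rw [setIntegral_cornerSimplex_succ i (hdfi i),
      setIntegral_congr_fun (isClosed_cornerSimplex k).measurableSet h1]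
    have hi : ∀ l : Fin (k + 2), IntegrableOn (fun t => f i (cornerFace l t)) (cornerSimplex k) :=
      fun l => ((hfd i).continuousOn.comp (hface l) fun t ht => cornerFace_mem l ht)
        |>.integrableOn_compact (isCompact_cornerSimplex k)
    have hi0 : IntegrableOn (fun t => f i (i.insertNth (1 - ∑ j, t j) t)) (cornerSimplex k) := by
      refine ContinuousOn.integrableOn_compact (isCompact_cornerSimplex k) ?_
      refine (hfd i).continuousOn.comp ?_ fun t ht => (insertNth_mem_cornerSimplex i _ t).2
        ⟨ht, sub_nonneg.2 ht.2, le_rfl⟩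
      refine Continuous.continuousOn (continuous_pi fun j => ?_)
      refine i.succAboveCases ?_ (fun j => ?_) j
      · simp only [Fin.insertNth_apply_same]; fun_prop
      · simp only [Fin.insertNth_apply_succAbove]; fun_prop
    simp only [cornerFace_zero, cornerFace_succ] at hi ⊢
    rw [integral_sub hi0 (by have := hi i.succ; simp only [cornerFace_succ] at this; exact this),
      setIntegral_insertNth_sub_sum]
  -- The alternating sum of the `df i` is `dη` on the standard frame.
  have hsum : ∑ i : Fin (k + 1), (-1 : ℝ) ^ i.val * ∫ t in cornerSimplex (k + 1), df i t = 0 := by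
    simp only [← integral_const_mul]
    rw [← integral_finsetSum _ fun i _ => (hdfi i).const_mul _]
    refine (setIntegral_congr_fun (isClosed_cornerSimplex (k + 1)).measurableSet
      (g := fun _ => 0) fun t ht => ?_).trans (by simp)
    have := extDerivWithin_apply (hη t ht)
      (uniqueDiffOn_cornerSimplex (k + 1) t ht) e
    rw [hd t ht] at this
    simpa using this.symm
  have h0 : ∫ t in cornerSimplex k, η (cornerFace 0 t)
      (fun j => cornerFaceLinear 0 (Pi.single j 1)) =
      ∑ i : Fin (k + 1), (-1 : ℝ) ^ i.val * ∫ t in cornerSimplex k, f i (cornerFace 0 t) := by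
    simp only [cornerFaceLinear_zero_single, ContinuousAlternatingMap.map_sub_single_zero,
      ← integral_const_mul]
    rw [integral_finsetSum]
    exact fun i _ => (((hfd i).continuousOn.comp (hface 0) fun t ht => cornerFace_mem 0 ht)
        |>.integrableOn_compact (isCompact_cornerSimplex k)).const_mul _
  have hs : ∀ i : Fin (k + 1), ∫ t in cornerSimplex k, η (cornerFace i.succ t)
      (fun j => cornerFaceLinear i.succ (Pi.single j 1)) =
      ∫ t in cornerSimplex k, f i (cornerFace i.succ t) := by
    intro i
    simp only [cornerFaceLinear_succ_single]
    rfl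
  rw [Fin.sum_univ_succ, h0]
  simp only [hs, Fin.val_zero, pow_zero, one_mul, Fin.val_succ, pow_succ, mul_neg, mul_one,
    neg_mul, Finset.sum_neg_distrib]
  rw [← sub_eq_add_neg, ← Finset.sum_sub_distrib]
  simp only [← mul_sub, ← hFTC]
  exact hsum

end Stokes

/-! ### Smoothing singular simplices of a manifold -/

section Smoothing

variable {n : ℕ} {M : Type u} [TopologicalSpace M] [ChartedSpace (EuclideanSpace ℝ (Fin n)) M]
  {k : ℕ}

variable (n M) in
/-- A chart together with the cutoff functions that are used to smooth maps to `M` on `core`. -/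
structure SmoothingChart where
  /-- The centre of the chart. -/
  center : M
  /-- A cutoff function that is supported in the domain of the chart. -/
  cutoff : M → ℝ
  /-- A smooth map to the model space that agrees with the chart on the support of `cutoff`. -/
  coord : M → EuclideanSpace ℝ (Fin n)
  /-- A closed set near which `cutoff` is `1`. -/
  core : Set M
  contMDiff_cutoff : ContMDiff (𝓡 n) 𝓘(ℝ, ℝ) ∞ cutoff
  contMDiff_coord : ContMDiff (𝓡 n) 𝓘(ℝ, EuclideanSpace ℝ (Fin n)) ∞ coord
  tsupport_subset : tsupport cutoff ⊆ (extChartAt (𝓡 n) center).source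
  smul_coord_sub : ∀ x ∈ (extChartAt (𝓡 n) center).source,
    cutoff x • (coord x - extChartAt (𝓡 n) center x) = 0
  isClosed_core : IsClosed core
  core_subset : core ⊆ interior (cutoff ⁻¹' {1})

/-- Two nested bump functions: `ψ` extends the chart to a smooth global map, and the cutoff `χ` is
supported where `ψ = 1`, so the extension is the chart wherever it is used. -/
theorem exists_smoothingChart [IsManifold (𝓡 n) ∞ M] [T3Space M] (x : M) :
    ∃ D : SmoothingChart n M, D.core ∈ 𝓝 x := by
  obtain ⟨ψ⟩ : Nonempty (SmoothBumpFunction (𝓡 n) x) := inferInstance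
  have hψ := ψ.eventuallyEq_one
  obtain ⟨χ, hχ⟩ : ∃ χ : SmoothBumpFunction (𝓡 n) x, tsupport χ ⊆ {y | ψ y = 1} :=
    (SmoothBumpFunction.nhds_basis_tsupport (I := 𝓡 n) x).mem_iff.1 hψ |>.imp fun _ h => h.2
  obtain ⟨K, hK, hKc, hKs⟩ := exists_mem_nhds_isClosed_subset
    (interior_mem_nhds.2 (show χ ⁻¹' {1} ∈ 𝓝 x from χ.eventuallyEq_one))
  refine ⟨⟨x, χ, fun y => ψ y • extChartAt (𝓡 n) x y, K, χ.contMDiff,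
    ψ.contMDiff_smul ?_, ?_, fun y hy => ?_, hKc, hKs⟩, hK⟩
  · exact contMDiffOn_extChartAt
  · rw [extChartAt_source]
    exact χ.tsupport_subset_chartAt_source
  · by_cases h : χ y = 0
    · simp [h]
    · have : ψ y = 1 := hχ (subset_tsupport _ h)
      simp [this]

/-! ### Smoothing in one chart -/

namespace SmoothingChart

variable (D : SmoothingChart n M)

/-- The coordinates of the map `f` after it has been smoothed where `D.cutoff` is `1`. -/
def smoothCoord (m : ℕ) (f : (Fin k → ℝ) → M) (t : Fin k → ℝ) : EuclideanSpace ℝ (Fin n) :=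
  extChartAt (𝓡 n) D.center (f t) + D.cutoff (f t) •
    (bernsteinCorner m (fun s => D.coord (f s)) t - extChartAt (𝓡 n) D.center (f t))

open Classical in
/-- The map `f` smoothed where `D.cutoff` is `1`, by a Bernstein polynomial of degree `m`. -/
def smooth (m : ℕ) (f : (Fin k → ℝ) → M) (t : Fin k → ℝ) : M :=
  if f t ∈ (extChartAt (𝓡 n) D.center).source then
    (extChartAt (𝓡 n) D.center).symm (D.smoothCoord m f t) else f t

theorem smooth_of_mem {m : ℕ} {f : (Fin k → ℝ) → M} {t : Fin k → ℝ}
    (h : f t ∈ (extChartAt (𝓡 n) D.center).source) :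
    D.smooth m f t = (extChartAt (𝓡 n) D.center).symm (D.smoothCoord m f t) := if_pos h

theorem smooth_of_notMem_tsupport {m : ℕ} {f : (Fin k → ℝ) → M} {t : Fin k → ℝ}
    (h : f t ∉ tsupport D.cutoff) : D.smooth m f t = f t := by
  rw [smooth]
  split_ifs with hs
  · rw [smoothCoord, image_eq_zero_of_notMem_tsupport h, zero_smul, add_zero,
      (extChartAt (𝓡 n) D.center).left_inv hs]
  · rfl

theorem smooth_congr {m : ℕ} {f g : (Fin k → ℝ) → M} (h : EqOn f g (cornerSimplex k)) :
    EqOn (D.smooth m f) (D.smooth m g) (cornerSimplex k) := by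
  intro t ht
  rw [smooth, smooth, smoothCoord, smoothCoord, h ht,
    bernsteinCorner_congr (h := fun s => D.coord (g s)) (fun s hs => by simp only [h hs]) ht]

theorem smooth_cornerFace {m : ℕ} (hm : m ≠ 0) (i : Fin (k + 2)) (f : (Fin (k + 1) → ℝ) → M)
    (t : Fin k → ℝ) :
    D.smooth m f (cornerFace i t) = D.smooth m (fun s => f (cornerFace i s)) t := by
  rw [smooth, smooth, smoothCoord, smoothCoord, bernsteinCorner_cornerFace hm]

/-- The condition under which `D.smooth m f` is given near `t` by regular formulas. -/
def SmoothableAt (m : ℕ) (f : (Fin k → ℝ) → M) (t : Fin k → ℝ) : Prop :=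
  f t ∉ tsupport D.cutoff ∨ (f t ∈ (extChartAt (𝓡 n) D.center).source ∧
    D.smoothCoord m f t ∈ (extChartAt (𝓡 n) D.center).target)

/-- The Bernstein polynomials converge to `coord` along `f₀` and not to the chart, but the cutoff
annihilates the difference of the two. -/
theorem tendsto_smoothCoord {f : ℕ → (Fin k → ℝ) → M} {f₀ : (Fin k → ℝ) → M}
    (h : TendstoContinuouslyOn f f₀ (cornerSimplex k)) {t : Fin k → ℝ} (ht : t ∈ cornerSimplex k)
    (hs : f₀ t ∈ (extChartAt (𝓡 n) D.center).source) :
    Tendsto (fun q : ℕ × (Fin k → ℝ) => D.smoothCoord q.1 (f q.1) q.2)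
      (atTop ×ˢ 𝓝[cornerSimplex k] t) (𝓝 (extChartAt (𝓡 n) D.center (f₀ t))) := by
  have h1 : Tendsto (fun q : ℕ × (Fin k → ℝ) => extChartAt (𝓡 n) D.center (f q.1 q.2))
      (atTop ×ˢ 𝓝[cornerSimplex k] t) (𝓝 (extChartAt (𝓡 n) D.center (f₀ t))) :=
    (continuousAt_extChartAt' hs).tendsto.comp (h t ht)
  have h2 : Tendsto (fun q : ℕ × (Fin k → ℝ) => D.cutoff (f q.1 q.2))
      (atTop ×ˢ 𝓝[cornerSimplex k] t) (𝓝 (D.cutoff (f₀ t))) :=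
    (D.contMDiff_cutoff.continuous.tendsto _).comp (h t ht)
  have h3 := tendstoContinuouslyOn_bernsteinCorner
    (q := fun m s => D.coord (f m s)) (q₀ := fun s => D.coord (f₀ s))
    (fun s hs => (D.contMDiff_coord.continuous.tendsto _).comp (h s hs)) t ht
  have := h1.add (h2.smul (h3.sub h1))
  rwa [D.smul_coord_sub _ hs, add_zero] at this

theorem eventually_smoothableAt {f : ℕ → (Fin k → ℝ) → M} {f₀ : (Fin k → ℝ) → M}
    (h : TendstoContinuouslyOn f f₀ (cornerSimplex k)) :
    ∀ᶠ m in atTop, ∀ t ∈ cornerSimplex k, D.SmoothableAt m (f m) t := by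
  refine (isCompact_cornerSimplex k).eventually_atTop_forall fun t ht => ?_
  by_cases hs : f₀ t ∈ tsupport D.cutoff
  · have hs' := D.tsupport_subset hs
    filter_upwards [(h t ht).eventually ((isOpen_extChartAt_source (I := 𝓡 n) D.center).mem_nhds
      hs'), (D.tendsto_smoothCoord h ht hs').eventually
        ((isOpen_extChartAt_target (I := 𝓡 n) D.center).mem_nhds
          ((extChartAt (𝓡 n) D.center).map_source hs'))] with q h1 h2
    exact Or.inr ⟨h1, h2⟩
  · filter_upwards [(h t ht).eventually ((isClosed_tsupport D.cutoff).isOpen_compl.mem_nhds hs)]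
      with q hq
    exact Or.inl hq

theorem tendsto_smooth {f : ℕ → (Fin k → ℝ) → M} {f₀ : (Fin k → ℝ) → M}
    (h : TendstoContinuouslyOn f f₀ (cornerSimplex k)) :
    TendstoContinuouslyOn (fun m => D.smooth m (f m)) f₀ (cornerSimplex k) := by
  intro t ht
  by_cases hs : f₀ t ∈ tsupport D.cutoff
  · have hs' := D.tsupport_subset hs
    have h1 := (continuousAt_extChartAt_symm' (I := 𝓡 n) hs').tendsto.comp
      (D.tendsto_smoothCoord h ht hs')
    rw [(extChartAt (𝓡 n) D.center).left_inv hs'] at h1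
    refine h1.congr' ?_
    filter_upwards [(h t ht).eventually ((isOpen_extChartAt_source (I := 𝓡 n) D.center).mem_nhds
      hs')] with q hq
    exact (D.smooth_of_mem hq).symm
  · refine (h t ht).congr' ?_
    filter_upwards [(h t ht).eventually ((isClosed_tsupport D.cutoff).isOpen_compl.mem_nhds hs)]
      with q hq
    exact (D.smooth_of_notMem_tsupport hq).symm

theorem contMDiffWithinAt_smooth [IsManifold (𝓡 n) ∞ M] {r : WithTop ℕ∞} (hr : r ≤ (∞ : ℕ∞ω)) {m : ℕ}
    {f : (Fin k → ℝ) → M} {t : Fin k → ℝ} (ht : t ∈ cornerSimplex k) (hD : D.SmoothableAt m f t)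
    (hf : ContMDiffWithinAt 𝓘(ℝ, Fin k → ℝ) (𝓡 n) r f (cornerSimplex k) t) :
    ContMDiffWithinAt 𝓘(ℝ, Fin k → ℝ) (𝓡 n) r (D.smooth m f) (cornerSimplex k) t := by
  have : IsManifold (𝓡 n) r M := IsManifold.of_le hr
  rcases hD with hD | ⟨hs, htgt⟩
  · refine hf.congr_of_eventuallyEq_of_mem ?_ ht
    filter_upwards [hf.continuousWithinAt.eventually
      ((isClosed_tsupport D.cutoff).isOpen_compl.mem_nhds hD)] with s hs
    exact D.smooth_of_notMem_tsupport hs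
  · have h1 : ContMDiffWithinAt 𝓘(ℝ, Fin k → ℝ) 𝓘(ℝ, EuclideanSpace ℝ (Fin n)) r
        (fun s => extChartAt (𝓡 n) D.center (f s)) (cornerSimplex k) t :=
      (contMDiffAt_extChartAt' (by rwa [extChartAt_source] at hs)).comp_contMDiffWithinAt t hf
    have h2 : ContMDiffWithinAt 𝓘(ℝ, Fin k → ℝ) 𝓘(ℝ, ℝ) r
        (fun s => D.cutoff (f s)) (cornerSimplex k) t :=
      ((D.contMDiff_cutoff.of_le hr) (f t)).comp_contMDiffWithinAt t hf
    have h3 : ContMDiffWithinAt 𝓘(ℝ, Fin k → ℝ) 𝓘(ℝ, EuclideanSpace ℝ (Fin n)) r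
        (bernsteinCorner m fun s => D.coord (f s)) (cornerSimplex k) t :=
      (contDiff_bernsteinCorner m _).contMDiff.contMDiffAt.contMDiffWithinAt
    have h4 : ContMDiffWithinAt 𝓘(ℝ, Fin k → ℝ) 𝓘(ℝ, EuclideanSpace ℝ (Fin n)) r
        (D.smoothCoord m f) (cornerSimplex k) t := h1.add (h2.smul (h3.sub h1))
    have h5 := (((contMDiffOn_extChartAt_symm (I := 𝓡 n) (n := r) D.center).contMDiffAt
      ((isOpen_extChartAt_target (I := 𝓡 n) D.center).mem_nhds htgt))).comp_contMDiffWithinAt t h4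
    refine h5.congr_of_eventuallyEq_of_mem ?_ ht
    filter_upwards [hf.continuousWithinAt.eventually
      ((isOpen_extChartAt_source (I := 𝓡 n) D.center).mem_nhds hs)] with s hs
    exact D.smooth_of_mem hs

/-- The gain of regularity: where the cutoff is `1` the old map drops out of `smoothCoord`, and only
the polynomial remains. -/
theorem contMDiffWithinAt_smooth_of_cutoff_eq_one [IsManifold (𝓡 n) ∞ M] {m : ℕ}
    {f : (Fin k → ℝ) → M} {t : Fin k → ℝ} (ht : t ∈ cornerSimplex k) (hD : D.SmoothableAt m f t)
    (hf : ContinuousWithinAt f (cornerSimplex k) t) (h1 : f t ∈ interior (D.cutoff ⁻¹' {1})) :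
    ContMDiffWithinAt 𝓘(ℝ, Fin k → ℝ) (𝓡 n) ∞ (D.smooth m f) (cornerSimplex k) t := by
  have hone : ∀ s, f s ∈ interior (D.cutoff ⁻¹' {1}) → D.smoothCoord m f s =
      bernsteinCorner m (fun s => D.coord (f s)) s := fun s hs => by
    rw [smoothCoord, show D.cutoff (f s) = 1 from interior_subset (s := D.cutoff ⁻¹' {1}) hs]
    simp
  have hmem : f t ∈ tsupport D.cutoff := subset_tsupport _ (by
    rw [Function.mem_support, show D.cutoff (f t) = 1 from interior_subset (s := D.cutoff ⁻¹' {1}) h1]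
    exact one_ne_zero)
  rcases hD with hD | ⟨hs, htgt⟩
  · exact absurd hmem hD
  rw [hone t h1] at htgt
  have h3 : ContMDiffWithinAt 𝓘(ℝ, Fin k → ℝ) 𝓘(ℝ, EuclideanSpace ℝ (Fin n)) ∞
      (bernsteinCorner m fun s => D.coord (f s)) (cornerSimplex k) t :=
    (contDiff_bernsteinCorner m _).contMDiff.contMDiffAt.contMDiffWithinAt
  have h5 := (((contMDiffOn_extChartAt_symm (I := 𝓡 n) (n := ∞) D.center).contMDiffAt
    ((isOpen_extChartAt_target (I := 𝓡 n) D.center).mem_nhds htgt))).comp_contMDiffWithinAt t h3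
  refine h5.congr_of_eventuallyEq_of_mem ?_ ht
  filter_upwards [hf.eventually ((isOpen_extChartAt_source (I := 𝓡 n) D.center).mem_nhds hs),
    hf.eventually (isOpen_interior.mem_nhds h1)] with s hs h1s
  rw [D.smooth_of_mem hs, hone s h1s, Function.comp_apply]

end SmoothingChart

/-! ### `C¹` convergence of the smoothed maps -/

variable (n) in
/-- Convergence in `C¹` of maps on the corner simplex to the manifold `M`, as continuous convergence
of the maps and of the derivatives of their compositions with `C¹` functions. -/
structure TendstoC1 (f : ℕ → (Fin k → ℝ) → M) (f₀ : (Fin k → ℝ) → M) : Prop where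
  tendsto : TendstoContinuouslyOn f f₀ (cornerSimplex k)
  contMDiffOn : ∀ᶠ m in atTop, ContMDiffOn 𝓘(ℝ, Fin k → ℝ) (𝓡 n) 1 (f m) (cornerSimplex k)
  contMDiffOn_lim : ContMDiffOn 𝓘(ℝ, Fin k → ℝ) (𝓡 n) 1 f₀ (cornerSimplex k)
  -- Testing with vector-valued `u` avoids comparing derivatives that live in different tangent
  -- spaces; charts, cutoffs and `coord` all serve as `u`.
  tendsto_fderivWithin : ∀ (F : Type) [NormedAddCommGroup F] [NormedSpace ℝ F] (u : M → F),
    ∀ t ∈ cornerSimplex k, ContMDiffAt (𝓡 n) 𝓘(ℝ, F) 1 u (f₀ t) →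
      Tendsto (fun q : ℕ × (Fin k → ℝ) =>
          fderivWithin ℝ (fun s => u (f q.1 s)) (cornerSimplex k) q.2)
        (atTop ×ˢ 𝓝[cornerSimplex k] t)
        (𝓝 (fderivWithin ℝ (fun s => u (f₀ s)) (cornerSimplex k) t))

theorem ContMDiffWithinAt.differentiableWithinAt_comp {F : Type*} [NormedAddCommGroup F]
    [NormedSpace ℝ F] {f : (Fin k → ℝ) → M} {s : Set (Fin k → ℝ)} {t : Fin k → ℝ} {u : M → F}
    (hf : ContMDiffWithinAt 𝓘(ℝ, Fin k → ℝ) (𝓡 n) 1 f s t)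
    (hu : ContMDiffAt (𝓡 n) 𝓘(ℝ, F) 1 u (f t)) :
    DifferentiableWithinAt ℝ (fun x => u (f x)) s t :=
  (contMDiffWithinAt_iff_contDiffWithinAt.1 (hu.comp_contMDiffWithinAt t hf)).differentiableWithinAt
    (by simp)

theorem tendstoC1_const [IsManifold (𝓡 n) ∞ M] {f₀ : (Fin k → ℝ) → M}
    (h : ContMDiffOn 𝓘(ℝ, Fin k → ℝ) (𝓡 n) 1 f₀ (cornerSimplex k)) :
    TendstoC1 n (fun _ => f₀) f₀ where
  tendsto t ht := (h.continuousOn t ht).tendsto.comp tendsto_snd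
  contMDiffOn := Eventually.of_forall fun _ => h
  contMDiffOn_lim := h
  tendsto_fderivWithin F _ _ u t ht hu := by
    have h1 : ContDiffWithinAt ℝ 1 (fun s => u (f₀ s)) (cornerSimplex k) t :=
      contMDiffWithinAt_iff_contDiffWithinAt.1 (hu.comp_contMDiffWithinAt t (h t ht))
    have h2 := h1.fderivWithin_right (m := 0) (uniqueDiffOn_cornerSimplex k) (by simp) ht
    exact h2.continuousWithinAt.tendsto.comp tendsto_snd

/-- In the chart, `u` of the smoothed map is `w ∘ smoothCoord` with `w = u ∘ φ⁻¹`. By the chain and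
product rules it suffices that the derivatives of the chart, the cutoff and the Bernstein
polynomials converge. Off the support of the cutoff nothing changes. -/
theorem SmoothingChart.tendstoC1_smooth [IsManifold (𝓡 n) ∞ M] (D : SmoothingChart n M)
    {f : ℕ → (Fin k → ℝ) → M} {f₀ : (Fin k → ℝ) → M} (h : TendstoC1 n f f₀) :
    TendstoC1 n (fun m => D.smooth m (f m)) f₀ where
  tendsto := D.tendsto_smooth h.tendsto
  contMDiffOn := by
    filter_upwards [D.eventually_smoothableAt h.tendsto, h.contMDiffOn] with m hm hfm t ht
    exact D.contMDiffWithinAt_smooth (by exact_mod_cast le_top) ht (hm t ht) (hfm t ht)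
  contMDiffOn_lim := h.contMDiffOn_lim
  tendsto_fderivWithin F _ _ u t ht hu := by
    have hmem : ∀ᶠ q : ℕ × (Fin k → ℝ) in atTop ×ˢ 𝓝[cornerSimplex k] t,
      q.2 ∈ cornerSimplex k := tendsto_snd.eventually self_mem_nhdsWithin
    have hC1 : ∀ᶠ q : ℕ × (Fin k → ℝ) in atTop ×ˢ 𝓝[cornerSimplex k] t,
      ContMDiffOn 𝓘(ℝ, Fin k → ℝ) (𝓡 n) 1 (f q.1) (cornerSimplex k) :=
      tendsto_fst.eventually h.contMDiffOn
    have : IsManifold (𝓡 n) 1 M := IsManifold.of_le (n := ∞) (by exact_mod_cast le_top)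
    by_cases hs : f₀ t ∈ tsupport D.cutoff
    · have hs' := D.tsupport_subset hs
      set φ := extChartAt (𝓡 n) D.center with hφ
      have hopen := isOpen_extChartAt_source (I := 𝓡 n) D.center
      have hsrc : ∀ᶠ q : ℕ × (Fin k → ℝ) in atTop ×ˢ 𝓝[cornerSimplex k] t,
          f q.1 q.2 ∈ φ.source := (h.tendsto t ht).eventually (hopen.mem_nhds hs')
      have hφat : ∀ x ∈ φ.source,
          ContMDiffAt (𝓡 n) 𝓘(ℝ, EuclideanSpace ℝ (Fin n)) 1 φ x := fun x hx =>
        contMDiffAt_extChartAt' (by rwa [hφ, extChartAt_source] at hx)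
      have hχ : ContMDiff (𝓡 n) 𝓘(ℝ, ℝ) 1 D.cutoff :=
        D.contMDiff_cutoff.of_le (by exact_mod_cast le_top)
      have hg : ContMDiff (𝓡 n) 𝓘(ℝ, EuclideanSpace ℝ (Fin n)) 1 D.coord :=
        D.contMDiff_coord.of_le (by exact_mod_cast le_top)
      set w : EuclideanSpace ℝ (Fin n) → F := fun y => u (φ.symm y) with hw
      have hwC : ContDiffAt ℝ 1 w (φ (f₀ t)) := by
        refine contMDiffAt_iff_contDiffAt.1 (ContMDiffAt.comp _ (g := u) ?_
          ((contMDiffOn_extChartAt_symm (I := 𝓡 n) (n := 1) D.center).contMDiffAt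
            ((isOpen_extChartAt_target (I := 𝓡 n) D.center).mem_nhds (φ.map_source hs'))))
        rwa [φ.left_inv hs']
      -- the coordinates and their limit
      have hh := D.tendsto_smoothCoord h.tendsto ht hs'
      -- One formula for two uses: `b` is a Bernstein polynomial for the smoothed maps, and `coord`
      -- along `f₀` for the limit.
      have hprod : ∀ (f : (Fin k → ℝ) → M) (b : (Fin k → ℝ) → EuclideanSpace ℝ (Fin n))
          (x : Fin k → ℝ), x ∈ cornerSimplex k →
          ContMDiffWithinAt 𝓘(ℝ, Fin k → ℝ) (𝓡 n) 1 f (cornerSimplex k) x → f x ∈ φ.source →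
          DifferentiableWithinAt ℝ b (cornerSimplex k) x →
          HasFDerivWithinAt (fun s => φ (f s) + D.cutoff (f s) • (b s - φ (f s)))
            (fderivWithin ℝ (fun s => φ (f s)) (cornerSimplex k) x +
              (D.cutoff (f x) • (fderivWithin ℝ b (cornerSimplex k) x -
                fderivWithin ℝ (fun s => φ (f s)) (cornerSimplex k) x) +
              (fderivWithin ℝ (fun s => D.cutoff (f s)) (cornerSimplex k) x).smulRight
                (b x - φ (f x)))) (cornerSimplex k) x := by
        intro f b x hx hf hfx hb
        have d1 := (hf.differentiableWithinAt_comp (hφat _ hfx)).hasFDerivWithinAt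
        have d2 := (hf.differentiableWithinAt_comp (hχ (f x))).hasFDerivWithinAt
        exact d1.fun_add (d2.fun_smul (hb.hasFDerivWithinAt.fun_sub d1))
      have hb : ∀ m, ∀ x, DifferentiableWithinAt ℝ
          (bernsteinCorner m fun s => D.coord (f m s)) (cornerSimplex k) x := fun m x =>
        ((contDiff_bernsteinCorner m _ (r := 1)).differentiable (by simp) x).differentiableWithinAt
      have hlim : Tendsto (fun q : ℕ × (Fin k → ℝ) =>
          fderivWithin ℝ (D.smoothCoord q.1 (f q.1)) (cornerSimplex k) q.2)
          (atTop ×ˢ 𝓝[cornerSimplex k] t)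
          (𝓝 (fderivWithin ℝ (fun s => φ (f₀ s)) (cornerSimplex k) t)) := by
        have hf0 := h.contMDiffOn_lim t ht
        -- The added term vanishes near `t`; it gives the limit the same shape as the
        -- approximations, so they can be compared term by term.
        have e0 : fderivWithin ℝ (fun s => φ (f₀ s)) (cornerSimplex k) t =
            fderivWithin ℝ (fun s => φ (f₀ s) + D.cutoff (f₀ s) • (D.coord (f₀ s) - φ (f₀ s)))
              (cornerSimplex k) t := by
          refine Filter.EventuallyEq.fderivWithin_eq_of_mem ?_ ht
          filter_upwards [hf0.continuousWithinAt.eventually (hopen.mem_nhds hs')] with s hs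
          rw [D.smul_coord_sub _ hs, add_zero]
        rw [e0, (hprod f₀ (fun s => D.coord (f₀ s)) t ht hf0 hs'
          (hf0.differentiableWithinAt_comp (hg _))).fderivWithin
            (uniqueDiffOn_cornerSimplex k t ht)]
        have l1 := h.tendsto_fderivWithin _ φ t ht (hφat _ hs')
        have l2 := h.tendsto_fderivWithin _ D.cutoff t ht (hχ _)
        have l3 := tendstoContinuouslyOn_fderivWithin_bernsteinCorner
          (g := fun m s => D.coord (f m s)) (g₀ := fun s => D.coord (f₀ s))
          (h.contMDiffOn.mono fun m hm x hx => (hm x hx).differentiableWithinAt_comp (hg _))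
          (fun x hx => h.tendsto_fderivWithin _ D.coord x hx (hg _)) t ht
        have l4 : Tendsto (fun q : ℕ × (Fin k → ℝ) => D.cutoff (f q.1 q.2))
            (atTop ×ˢ 𝓝[cornerSimplex k] t) (𝓝 (D.cutoff (f₀ t))) :=
          (hχ.continuous.tendsto _).comp (h.tendsto t ht)
        have l5 := tendstoContinuouslyOn_bernsteinCorner
          (q := fun m s => D.coord (f m s)) (q₀ := fun s => D.coord (f₀ s))
          (fun s hs => (hg.continuous.tendsto _).comp (h.tendsto s hs)) t ht
        have l6 : Tendsto (fun q : ℕ × (Fin k → ℝ) => φ (f q.1 q.2))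
            (atTop ×ˢ 𝓝[cornerSimplex k] t) (𝓝 (φ (f₀ t))) :=
          (continuousAt_extChartAt' hs').tendsto.comp (h.tendsto t ht)
        have l7 := (isBoundedBilinearMap_smulRight (𝕜 := ℝ) (E := Fin k → ℝ)
          (F := EuclideanSpace ℝ (Fin n))).continuous.tendsto
            (fderivWithin ℝ (fun s => D.cutoff (f₀ s)) (cornerSimplex k) t,
              D.coord (f₀ t) - φ (f₀ t)) |>.comp (l2.prodMk_nhds (l5.sub l6))
        refine (l1.add ((l4.smul (l3.sub l1)).add l7)).congr' ?_
        filter_upwards [hmem, hC1, hsrc] with q hq hq1 hq2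
        exact ((hprod (f q.1) _ q.2 hq (hq1 _ hq) hq2 (hb q.1 q.2)).fderivWithin
          (uniqueDiffOn_cornerSimplex k q.2 hq)).symm
      have hwlim : Tendsto (fun q : ℕ × (Fin k → ℝ) =>
          fderiv ℝ w (D.smoothCoord q.1 (f q.1) q.2)) (atTop ×ˢ 𝓝[cornerSimplex k] t)
          (𝓝 (fderiv ℝ w (φ (f₀ t)))) :=
        ((hwC.fderiv_right (m := 0) (by simp)).continuousAt.tendsto).comp hh
      have e1 : fderivWithin ℝ (fun s => u (f₀ s)) (cornerSimplex k) t =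
          (fderiv ℝ w (φ (f₀ t))).comp (fderivWithin ℝ (fun s => φ (f₀ s)) (cornerSimplex k) t) := by
        have hf0 := h.contMDiffOn_lim t ht
        rw [← fderiv_comp_fderivWithin t (hwC.differentiableAt (by simp))
          (hf0.differentiableWithinAt_comp (hφat _ hs')) (uniqueDiffOn_cornerSimplex k t ht)]
        refine Filter.EventuallyEq.fderivWithin_eq_of_mem ?_ ht
        filter_upwards [hf0.continuousWithinAt.eventually (hopen.mem_nhds hs')] with s hs
        simp only [hw, Function.comp_apply, φ.left_inv hs]
      rw [e1]
      refine (((ContinuousLinearMap.compL ℝ (Fin k → ℝ) (EuclideanSpace ℝ (Fin n)) F).isBoundedBilinearMap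
        |>.continuous.tendsto (_, _)).comp (hwlim.prodMk_nhds hlim)).congr' ?_
      have hwd : ∀ᶠ q : ℕ × (Fin k → ℝ) in atTop ×ˢ 𝓝[cornerSimplex k] t,
          ContDiffAt ℝ 1 w (D.smoothCoord q.1 (f q.1) q.2) :=
        hh.eventually (hwC.eventually (by simp))
      filter_upwards [hmem, hC1, hsrc, hwd, eventually_prod_eventually_nhdsWithin
        (P := fun m x => f m x ∈ φ.source) hsrc] with q hq hq1 hq2 hq3 hq4
      rw [Function.comp_apply, ContinuousLinearMap.compL_apply,
        ← fderiv_comp_fderivWithin q.2 (hq3.differentiableAt (by simp))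
        (hprod (f q.1) _ q.2 hq (hq1 _ hq) hq2 (hb q.1 q.2)).differentiableWithinAt
          (uniqueDiffOn_cornerSimplex k q.2 hq)]
      refine (Filter.EventuallyEq.fderivWithin_eq_of_mem ?_ hq).symm
      filter_upwards [hq4] with s hs
      simp only [hw, Function.comp_apply, D.smooth_of_mem hs]
      rfl
    · refine (h.tendsto_fderivWithin F u t ht hu).congr' ?_
      have hns : ∀ᶠ q : ℕ × (Fin k → ℝ) in atTop ×ˢ 𝓝[cornerSimplex k] t,
          f q.1 q.2 ∉ tsupport D.cutoff :=
        (h.tendsto t ht).eventually ((isClosed_tsupport D.cutoff).isOpen_compl.mem_nhds hs)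
      filter_upwards [hmem, eventually_prod_eventually_nhdsWithin
        (P := fun m x => f m x ∉ tsupport D.cutoff) hns] with q hq hq'
      refine (Filter.EventuallyEq.fderivWithin_eq_of_mem ?_ hq).symm
      filter_upwards [hq'] with s hs
      rw [D.smooth_of_notMem_tsupport hs]

/-- The map `f` smoothed on the cores of all the charts of the list `L`. -/
def smoothAll (L : List (SmoothingChart n M)) (m : ℕ) (f : (Fin k → ℝ) → M) : (Fin k → ℝ) → M :=
  L.foldr (fun D g => D.smooth m g) f

theorem smoothAll_congr (L : List (SmoothingChart n M)) {m : ℕ} {f g : (Fin k → ℝ) → M}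
    (h : EqOn f g (cornerSimplex k)) :
    EqOn (smoothAll L m f) (smoothAll L m g) (cornerSimplex k) := by
  induction L with
  | nil => exact h
  | cons D L ih => exact D.smooth_congr ih

theorem smoothAll_cornerFace (L : List (SmoothingChart n M)) {m : ℕ} (hm : m ≠ 0) (i : Fin (k + 2))
    (f : (Fin (k + 1) → ℝ) → M) (t : Fin k → ℝ) :
    smoothAll L m f (cornerFace i t) = smoothAll L m (fun s => f (cornerFace i s)) t := by
  induction L generalizing t with
  | nil => rfl
  | cons D L ih =>
    have : (fun s => smoothAll L m f (cornerFace i s)) =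
      smoothAll L m fun s => f (cornerFace i s) := funext ih
    exact (D.smooth_cornerFace hm i (smoothAll L m f) t).trans (congrArg (D.smooth m · t) this)

theorem tendsto_smoothAll (L : List (SmoothingChart n M)) {f : (Fin k → ℝ) → M}
    (hf : ContinuousOn f (cornerSimplex k)) :
    TendstoContinuouslyOn (fun m => smoothAll L m f) f (cornerSimplex k) := by
  induction L with
  | nil => exact fun t ht => (hf t ht).tendsto.comp tendsto_snd
  | cons D L ih => exact D.tendsto_smooth ih

theorem tendstoC1_smoothAll [IsManifold (𝓡 n) ∞ M] (L : List (SmoothingChart n M))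
    {f : (Fin k → ℝ) → M} (hf : ContMDiffOn 𝓘(ℝ, Fin k → ℝ) (𝓡 n) 1 f (cornerSimplex k)) :
    TendstoC1 n (fun m => smoothAll L m f) f := by
  induction L with
  | nil => exact tendstoC1_const hf
  | cons D L ih => exact D.tendstoC1_smooth ih

theorem eventually_continuousOn_smoothAll [IsManifold (𝓡 n) ∞ M] (L : List (SmoothingChart n M))
    {f : (Fin k → ℝ) → M} (hf : ContinuousOn f (cornerSimplex k)) :
    ∀ᶠ m in atTop, ContinuousOn (smoothAll L m f) (cornerSimplex k) := by
  induction L with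
  | nil => exact Eventually.of_forall fun _ => hf
  | cons D L ih =>
    filter_upwards [ih, D.eventually_smoothableAt (tendsto_smoothAll L hf)] with m hm hD t ht
    exact (D.contMDiffWithinAt_smooth (r := 0) (by simp) ht (hD t ht)
      (contMDiffOn_zero_iff.2 hm t ht)).continuousWithinAt

/-- Each chart makes the map smooth over its core, and later charts preserve smoothness already
gained. The earlier smoothings move points only slightly, so a point that starts in the closed core
is still inside the region `cutoff = 1` when its chart is applied. -/
theorem eventually_contMDiffWithinAt_smoothAll [IsManifold (𝓡 n) ∞ M]
    (L : List (SmoothingChart n M)) {f : (Fin k → ℝ) → M}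
    (hf : ContinuousOn f (cornerSimplex k)) :
    ∀ᶠ m in atTop, ∀ t ∈ cornerSimplex k, (∃ D ∈ L, f t ∈ D.core) →
      ContMDiffWithinAt 𝓘(ℝ, Fin k → ℝ) (𝓡 n) ∞ (smoothAll L m f) (cornerSimplex k) t := by
  induction L with
  | nil => simp
  | cons D L ih =>
    have hcore : ∀ᶠ m in atTop, ∀ t ∈ cornerSimplex k, f t ∈ D.core →
        smoothAll L m f t ∈ interior (D.cutoff ⁻¹' {1}) := by
      refine (isCompact_cornerSimplex k).eventually_atTop_forall
        (P := fun m t => f t ∈ D.core → smoothAll L m f t ∈ interior (D.cutoff ⁻¹' {1}))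
        fun t ht => ?_
      by_cases hc : f t ∈ D.core
      · filter_upwards [(tendsto_smoothAll L hf t ht).eventually
          (isOpen_interior.mem_nhds (D.core_subset hc))] with q hq _
        exact hq
      · filter_upwards [tendsto_snd.eventually
          ((hf t ht).eventually (D.isClosed_core.isOpen_compl.mem_nhds hc))] with q hq hq'
        exact absurd hq' hq
    filter_upwards [ih, D.eventually_smoothableAt (tendsto_smoothAll L hf), hcore,
      eventually_continuousOn_smoothAll L hf] with m h1 h2 h3 h4 t ht hex
    rcases List.exists_mem_cons_iff .. |>.1 hex with hex | hex
    · exact D.contMDiffWithinAt_smooth_of_cutoff_eq_one ht (h2 t ht) (h4 t ht) (h3 t ht hex)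
    · exact D.contMDiffWithinAt_smooth le_rfl ht (h2 t ht) (h1 t ht hex)

theorem exists_smoothingCharts_cover [IsManifold (𝓡 n) ∞ M] [T3Space M] {K : Set M}
    (hK : IsCompact K) : ∃ L : List (SmoothingChart n M), ∀ x ∈ K, ∃ D ∈ L, x ∈ D.core := by
  refine hK.induction_on ⟨[], by simp⟩ ?_ ?_ ?_
  · exact fun S T hST ⟨L, hL⟩ => ⟨L, fun x hx => hL x (hST hx)⟩
  · rintro S T ⟨L, hL⟩ ⟨L', hL'⟩
    refine ⟨L ++ L', fun x hx => ?_⟩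
    rcases hx with hx | hx
    · obtain ⟨D, hD, h⟩ := hL x hx
      exact ⟨D, List.mem_append_left _ hD, h⟩
    · obtain ⟨D, hD, h⟩ := hL' x hx
      exact ⟨D, List.mem_append_right _ hD, h⟩
  · intro x _
    obtain ⟨D, hD⟩ := exists_smoothingChart (n := n) x
    exact ⟨D.core, mem_nhdsWithin_of_mem_nhds hD, [D], fun y hy => ⟨D, by simp, hy⟩⟩

end Smoothing

/-! ### Integrals of forms over maps of the corner simplex -/

theorem ContDiffWithinAt.compContinuousLinearMap_apply {V E F : Type*} [NormedAddCommGroup V]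
    [NormedSpace ℝ V] [NormedAddCommGroup E] [NormedSpace ℝ E] [NormedAddCommGroup F]
    [NormedSpace ℝ F] {k : ℕ} {r : WithTop ℕ∞} {A : V → E [⋀^Fin k]→L[ℝ] ℝ} {L : V → F →L[ℝ] E}
    {s : Set V} {x : V} (hA : ContDiffWithinAt ℝ r A s x) (hL : ContDiffWithinAt ℝ r L s x)
    (v : Fin k → F) :
    ContDiffWithinAt ℝ r (fun y => (A y).compContinuousLinearMap (L y) v) s x := by
  have h1 : ContDiffWithinAt ℝ r (fun y => (A y).toContinuousMultilinearMap) s x :=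
    (ContinuousAlternatingMap.toContinuousMultilinearMapLI (𝕜 := ℝ) (E := E) (F := ℝ)
      (ι := Fin k)).contDiff.contDiffAt.comp_contDiffWithinAt x hA
  have h2 : ContDiffWithinAt ℝ r (fun y =>
      ContinuousMultilinearMap.compContinuousLinearMapContinuousMultilinear ℝ
        (fun _ : Fin k => F) (fun _ : Fin k => E) ℝ (fun _ => L y)) s x :=
    (ContinuousMultilinearMap.contDiff _).contDiffAt.comp_contDiffWithinAt x
      (contDiffWithinAt_pi.2 fun _ => hL)
  have h3 := h2.clm_apply h1
  exact (ContinuousMultilinearMap.apply ℝ (fun _ : Fin k => F) ℝ v).contDiff.contDiffAt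
      |>.comp_contDiffWithinAt x h3

section FormIntegrals

variable {n : ℕ} {M : Type u} [TopologicalSpace M] [ChartedSpace (EuclideanSpace ℝ (Fin n)) M]
  {k j : ℕ}

/-- The pullback of the form `η` by the map `f` of the corner simplex. -/
def FormField.pullback (η : FormField n M k) (f : (Fin j → ℝ) → M) (t : Fin j → ℝ) :
    (Fin j → ℝ) [⋀^Fin k]→L[ℝ] ℝ :=
  (η (f t)).compContinuousLinearMap
    (mfderivWithin 𝓘(ℝ, Fin j → ℝ) (𝓡 n) f (cornerSimplex j) t)

/-- The integral of the form `η` over the map `f` of the corner simplex. -/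
def FormField.integralMap (η : FormField n M k) (f : (Fin k → ℝ) → M) : ℝ :=
  ∫ t in cornerSimplex k, η.pullback f t fun i => Pi.single i 1

theorem FormField.integralSimplex_eq_integralMap (η : FormField n M k) (σ : SingularSimplex M k) :
    η.integralSimplex σ = η.integralMap (simplexInCoords σ) := rfl

theorem mfderivWithin_cornerSimplex_congr {f g : (Fin j → ℝ) → M} {t : Fin j → ℝ}
    (h : EqOn f g (cornerSimplex j)) (ht : t ∈ cornerSimplex j) :
    (mfderivWithin 𝓘(ℝ, Fin j → ℝ) (𝓡 n) f (cornerSimplex j) t :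
      (Fin j → ℝ) →L[ℝ] EuclideanSpace ℝ (Fin n)) =
    (mfderivWithin 𝓘(ℝ, Fin j → ℝ) (𝓡 n) g (cornerSimplex j) t :
      (Fin j → ℝ) →L[ℝ] EuclideanSpace ℝ (Fin n)) := by
  exact mfderivWithin_congr h (h ht)

/-- All tangent spaces are definitionally the model space, so values of a form at equal points can
be compared without transport. -/
theorem FormField.apply_congr (η : FormField n M k) {x y : M} (h : x = y)
    (v : Fin k → EuclideanSpace ℝ (Fin n)) :
    (η x : EuclideanSpace ℝ (Fin n) [⋀^Fin k]→L[ℝ] ℝ) v =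
      (η y : EuclideanSpace ℝ (Fin n) [⋀^Fin k]→L[ℝ] ℝ) v := by
  subst h; rfl

theorem FormField.pullback_congr (η : FormField n M k) {f g : (Fin j → ℝ) → M}
    (h : EqOn f g (cornerSimplex j)) : EqOn (η.pullback f) (η.pullback g) (cornerSimplex j) := by
  intro t ht
  ext v
  have h1 := mfderivWithin_cornerSimplex_congr (n := n) h ht
  refine (η.apply_congr (h ht) _).trans ?_
  exact congrArg (η (g t) : EuclideanSpace ℝ (Fin n) [⋀^Fin k]→L[ℝ] ℝ)
    (funext fun i => DFunLike.congr_fun h1 (v i))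

theorem FormField.integralMap_congr (η : FormField n M k) {f g : (Fin k → ℝ) → M}
    (h : EqOn f g (cornerSimplex k)) : η.integralMap f = η.integralMap g :=
  setIntegral_congr_fun (isClosed_cornerSimplex k).measurableSet fun t ht => by
    simp only [η.pullback_congr h ht]

/-- Chain rule for `f = φ⁻¹ ∘ (φ ∘ f)`, valid near `t`. It reduces all analysis of pullbacks to
forms and maps between vector spaces. -/
theorem FormField.pullback_eq_inChart [IsManifold (𝓡 n) ∞ M] (η : FormField n M k) {x₀ : M}
    {f : (Fin j → ℝ) → M} {t : Fin j → ℝ} (ht : t ∈ cornerSimplex j)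
    (hf : ContMDiffWithinAt 𝓘(ℝ, Fin j → ℝ) (𝓡 n) 1 f (cornerSimplex j) t)
    (hs : f t ∈ (extChartAt (𝓡 n) x₀).source) :
    η.pullback f t = (η.inChart x₀ (extChartAt (𝓡 n) x₀ (f t))).compContinuousLinearMap
      (fderivWithin ℝ (fun s => extChartAt (𝓡 n) x₀ (f s)) (cornerSimplex j) t) := by
  have : IsManifold (𝓡 n) 1 M := IsManifold.of_le (n := ∞) (by exact_mod_cast le_top)
  set φ := extChartAt (𝓡 n) x₀ with hφ
  have hu := uniqueDiffOn_cornerSimplex j t ht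
  have h1 : MDifferentiableAt 𝓘(ℝ, EuclideanSpace ℝ (Fin n)) (𝓡 n) φ.symm (φ (f t)) :=
    ((contMDiffOn_extChartAt_symm (I := 𝓡 n) (n := 1) x₀).contMDiffAt
      ((isOpen_extChartAt_target (I := 𝓡 n) x₀).mem_nhds (φ.map_source hs))).mdifferentiableAt
        (by simp)
  have h2 : DifferentiableWithinAt ℝ (fun s => φ (f s)) (cornerSimplex j) t :=
    hf.differentiableWithinAt_comp (contMDiffAt_extChartAt' (by rwa [hφ, extChartAt_source] at hs))
  have h3 := mfderiv_comp_mfderivWithin t h1 h2.mdifferentiableWithinAt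
    (uniqueMDiffWithinAt_iff_uniqueDiffWithinAt.2 hu)
  rw [mfderivWithin_eq_fderivWithin] at h3
  have h4 : (mfderivWithin 𝓘(ℝ, Fin j → ℝ) (𝓡 n) f (cornerSimplex j) t :
      (Fin j → ℝ) →L[ℝ] EuclideanSpace ℝ (Fin n)) =
      mfderivWithin 𝓘(ℝ, Fin j → ℝ) (𝓡 n) (φ.symm ∘ fun s => φ (f s)) (cornerSimplex j) t := by
    suffices hev : φ.symm ∘ (fun s => φ (f s)) =ᶠ[𝓝[cornerSimplex j] t] f from
      (hev.mfderivWithin_eq (I := 𝓘(ℝ, Fin j → ℝ)) (I' := 𝓡 n) (φ.left_inv hs)).symm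
    filter_upwards [hf.continuousWithinAt.eventually
      ((isOpen_extChartAt_source (I := 𝓡 n) x₀).mem_nhds hs)] with s hs
    exact φ.left_inv hs
  have h5 := h4.trans h3
  ext v
  refine (η.apply_congr (φ.left_inv hs).symm _).trans ?_
  exact congrArg (η (φ.symm (φ (f t))) : EuclideanSpace ℝ (Fin n) [⋀^Fin k]→L[ℝ] ℝ)
    (funext fun i => DFunLike.congr_fun h5 (v i))

theorem TendstoC1.tendsto_pullback [IsManifold (𝓡 n) ∞ M] {η : FormField n M k}
    (hη : η.IsClosedForm) {f : ℕ → (Fin j → ℝ) → M} {f₀ : (Fin j → ℝ) → M}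
    (h : TendstoC1 n f f₀) (v : Fin k → Fin j → ℝ) :
    TendstoContinuouslyOn (fun m t => η.pullback (f m) t v) (fun t => η.pullback f₀ t v)
      (cornerSimplex j) := by
  intro t ht
  have : IsManifold (𝓡 n) 1 M := IsManifold.of_le (n := ∞) (by exact_mod_cast le_top)
  set φ := extChartAt (𝓡 n) (f₀ t) with hφ
  have hs : f₀ t ∈ φ.source := mem_extChartAt_source (f₀ t)
  have hopen := isOpen_extChartAt_source (I := 𝓡 n) (f₀ t)
  have l1 := h.tendsto_fderivWithin _ φ t ht (contMDiffAt_extChartAt' (by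
    rwa [hφ, extChartAt_source] at hs))
  have l2 : Tendsto (fun q : ℕ × (Fin j → ℝ) => φ (f q.1 q.2))
      (atTop ×ˢ 𝓝[cornerSimplex j] t) (𝓝 (φ (f₀ t))) :=
    (continuousAt_extChartAt' hs).tendsto.comp (h.tendsto t ht)
  have l3 := ((hη.smooth (f₀ t)).continuousOn.continuousAt
    ((isOpen_extChartAt_target (I := 𝓡 n) (f₀ t)).mem_nhds (φ.map_source hs))).tendsto.comp l2
  have l4 : Tendsto (fun q : ℕ × (Fin j → ℝ) => fun i =>
      fderivWithin ℝ (fun s => φ (f q.1 s)) (cornerSimplex j) q.2 (v i))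
      (atTop ×ˢ 𝓝[cornerSimplex j] t)
      (𝓝 fun i => fderivWithin ℝ (fun s => φ (f₀ s)) (cornerSimplex j) t (v i)) :=
    tendsto_pi_nhds.2 fun i =>
      ((ContinuousLinearMap.apply ℝ (EuclideanSpace ℝ (Fin n)) (v i)).continuous.tendsto _).comp l1
  have l5 := l3.eval l4
  have e0 := η.pullback_eq_inChart ht (h.contMDiffOn_lim t ht) hs
  simp only [e0]
  refine l5.congr' ?_
  filter_upwards [tendsto_snd.eventually self_mem_nhdsWithin,
    tendsto_fst.eventually h.contMDiffOn, (h.tendsto t ht).eventually (hopen.mem_nhds hs)]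
    with q h1 h2 h3
  simp only [η.pullback_eq_inChart h1 (h2 _ h1) h3]
  rfl

theorem FormField.IsClosedForm.continuousOn_pullback [IsManifold (𝓡 n) ∞ M]
    {η : FormField n M k} (hη : η.IsClosedForm) {f : (Fin j → ℝ) → M}
    (hf : ContMDiffOn 𝓘(ℝ, Fin j → ℝ) (𝓡 n) 1 f (cornerSimplex j)) (v : Fin k → Fin j → ℝ) :
    ContinuousOn (fun t => η.pullback f t v) (cornerSimplex j) := by
  intro t ht
  -- Continuous convergence of a constant sequence is continuity.
  have h := (tendstoC1_const hf).tendsto_pullback hη v t ht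
  rw [ContinuousWithinAt, ← map_snd_prod (atTop : Filter ℕ) (𝓝[cornerSimplex j] t)]
  exact tendsto_map'_iff.2 h

theorem TendstoC1.tendsto_integralMap [IsManifold (𝓡 n) ∞ M] {η : FormField n M k}
    (hη : η.IsClosedForm) {f : ℕ → (Fin k → ℝ) → M} {f₀ : (Fin k → ℝ) → M}
    (h : TendstoC1 n f f₀) :
    Tendsto (fun m => η.integralMap (f m)) atTop (𝓝 (η.integralMap f₀)) := by
  have hpb := h.tendsto_pullback hη fun i => Pi.single i 1
  obtain ⟨K, hK⟩ := hpb.exists_bound (isCompact_cornerSimplex k)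
  have hms := (isClosed_cornerSimplex k).measurableSet
  have : IsFiniteMeasure (volume.restrict (cornerSimplex k)) :=
    ⟨by simpa using (isCompact_cornerSimplex k).measure_lt_top⟩
  refine tendsto_integral_filter_of_dominated_convergence (fun _ => K) ?_ ?_
    (integrable_const K) ?_
  · filter_upwards [h.contMDiffOn] with m hm
    exact (hη.continuousOn_pullback hm _).aestronglyMeasurable hms
  · filter_upwards [hK] with m hm
    exact (ae_restrict_iff' hms).2 (ae_of_all _ hm)
  · refine (ae_restrict_iff' hms).2 (ae_of_all _ fun t ht => ?_)
    exact (hpb t ht).comp (tendsto_id.prodMk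
      (tendsto_const_pure.mono_right (pure_le_nhdsWithin ht)))

theorem FormField.pullback_comp_cornerFace [IsManifold (𝓡 n) ∞ M] (η : FormField n M k)
    {f : (Fin (j + 1) → ℝ) → M}
    (hf : ContMDiffOn 𝓘(ℝ, Fin (j + 1) → ℝ) (𝓡 n) 1 f (cornerSimplex (j + 1))) (i : Fin (j + 2))
    {t : Fin j → ℝ} (ht : t ∈ cornerSimplex j) :
    η.pullback (fun s => f (cornerFace i s)) t =
      (η.pullback f (cornerFace i t)).compContinuousLinearMap (cornerFaceLinear i) := by
  have h1 : HasMFDerivWithinAt 𝓘(ℝ, Fin j → ℝ) 𝓘(ℝ, Fin (j + 1) → ℝ) (cornerFace i)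
      (cornerSimplex j) t (cornerFaceLinear i) :=
    (hasFDerivAt_cornerFace i t).hasFDerivWithinAt.hasMFDerivWithinAt
  have h2 := ((hf _ (cornerFace_mem i ht)).mdifferentiableWithinAt (by simp)).hasMFDerivWithinAt
  have h3 := (HasMFDerivWithinAt.comp t h2 h1 fun s hs => cornerFace_mem i hs).mfderivWithin
    (uniqueMDiffWithinAt_iff_uniqueDiffWithinAt.2 (uniqueDiffOn_cornerSimplex j t ht))
  ext v
  exact congrArg (η (f (cornerFace i t)) : EuclideanSpace ℝ (Fin n) [⋀^Fin k]→L[ℝ] ℝ)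
    (funext fun i => DFunLike.congr_fun h3 (v i))

/-- Stokes' theorem for closed forms and smooth maps of the corner simplex. -/
theorem FormField.IsClosedForm.sum_integralMap_cornerFace_eq_zero [IsManifold (𝓡 n) ∞ M]
    {η : FormField n M k} (hη : η.IsClosedForm) {f : (Fin (k + 1) → ℝ) → M}
    (hf : ContMDiffOn 𝓘(ℝ, Fin (k + 1) → ℝ) (𝓡 n) ∞ f (cornerSimplex (k + 1))) :
    ∑ i : Fin (k + 2), (-1) ^ i.val * η.integralMap (fun t => f (cornerFace i t)) = 0 := by
  have : IsManifold (𝓡 n) 1 M := IsManifold.of_le (n := ∞) (by exact_mod_cast le_top)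
  have hf1 : ContMDiffOn 𝓘(ℝ, Fin (k + 1) → ℝ) (𝓡 n) 1 f (cornerSimplex (k + 1)) :=
    hf.of_le (by exact_mod_cast le_top)
  -- Near `t` the pullback is computed in the single chart at `f t`. It contains the first
  -- derivative of `f`, so a `C¹` pullback needs more than a `C¹` map; smoothness of `f` provides
  -- this.
  have hlocal : ∀ t ∈ cornerSimplex (k + 1),
      η.pullback f =ᶠ[𝓝[cornerSimplex (k + 1)] t] fun s =>
        (η.inChart (f t) (extChartAt (𝓡 n) (f t) (f s))).compContinuousLinearMap
          (fderivWithin ℝ (fun s => extChartAt (𝓡 n) (f t) (f s)) (cornerSimplex (k + 1)) s) := by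
    intro t ht
    filter_upwards [self_mem_nhdsWithin, (hf1 t ht).continuousWithinAt.eventually
      ((isOpen_extChartAt_source (I := 𝓡 n) (f t)).mem_nhds (mem_extChartAt_source (f t)))]
      with s hs hs'
    exact η.pullback_eq_inChart hs (hf1 s hs) hs'
  have hchart : ∀ t ∈ cornerSimplex (k + 1),
      ContDiffWithinAt ℝ ∞ (fun s => extChartAt (𝓡 n) (f t) (f s)) (cornerSimplex (k + 1)) t :=
    fun t ht => contMDiffWithinAt_iff_contDiffWithinAt.1
      ((contMDiffAt_extChartAt (I := 𝓡 n) (n := ∞)).comp_contMDiffWithinAt t (hf t ht))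
  have hderiv : ∀ t ∈ cornerSimplex (k + 1), ContDiffWithinAt ℝ 1
      (fderivWithin ℝ (fun s => extChartAt (𝓡 n) (f t) (f s)) (cornerSimplex (k + 1)))
      (cornerSimplex (k + 1)) t := fun t ht =>
    (hchart t ht).fderivWithin_right (uniqueDiffOn_cornerSimplex _)
      (WithTop.coe_le_coe.2 (le_top : (1 + 1 : ℕ∞) ≤ ⊤)) ht
  have hform : ∀ t, ContDiffAt ℝ ∞ (η.inChart (f t)) (extChartAt (𝓡 n) (f t) (f t)) := fun t =>
    (hη.smooth (f t)).contDiffAt ((isOpen_extChartAt_target (I := 𝓡 n) (f t)).mem_nhds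
      (mem_extChartAt_target (f t)))
  have hcoef : ∀ t ∈ cornerSimplex (k + 1), ContDiffWithinAt ℝ 1
      (fun s => η.inChart (f t) (extChartAt (𝓡 n) (f t) (f s))) (cornerSimplex (k + 1)) t :=
    fun t ht => ((hform t).comp_contDiffWithinAt t (hchart t ht)).of_le (by exact_mod_cast le_top)
  have key := sum_setIntegral_cornerFace_eq_zero (η := η.pullback f) ?_ ?_ ?_
  · rw [← key]
    refine Finset.sum_congr rfl fun i _ => ?_
    congr 1
    refine setIntegral_congr_fun (isClosed_cornerSimplex k).measurableSet fun t ht => ?_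
    simp only [η.pullback_comp_cornerFace hf1 i ht]
    rfl
  · intro t ht
    refine DifferentiableWithinAt.congr_of_eventuallyEq_of_mem ?_ (hlocal t ht) ht
    exact ((hcoef t ht).differentiableWithinAt
      (by simp)).continuousAlternatingMapCompContinuousLinearMap
        ((hderiv t ht).differentiableWithinAt (by simp))
  · intro v t ht
    refine ContDiffWithinAt.congr_of_eventuallyEq_of_mem
      ((hcoef t ht).compContinuousLinearMap_apply (hderiv t ht) v) ?_ ht
    filter_upwards [hlocal t ht] with s hs
    rw [hs]
  · intro t ht
    rw [(hlocal t ht).extDerivWithin_eq_of_mem ht, extDerivWithin_pullback (r := ∞) (t := univ)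
      (f := fun s => extChartAt (𝓡 n) (f t) (f s))
      ((hform t).differentiableAt (by simp)).differentiableWithinAt (hchart t ht)
      (minSmoothness_of_isRCLikeNormedField.trans_le
        (WithTop.coe_le_coe.2 (le_top : (2 : ℕ∞) ≤ ⊤)))
      (uniqueDiffOn_cornerSimplex _)
      (cornerSimplex_subset_closure_interior _ ht) ht (mapsTo_univ _ _), extDerivWithin_univ,
      hη.closed _ _ (mem_extChartAt_target (f t))]
    rfl

end FormIntegrals

/-! ### Singular chains -/

section SingularChains

variable {X : Type u} [TopologicalSpace X] {k : ℕ}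

/-- The `i`-th face of a singular simplex. -/
def singularFace (i : Fin (k + 2)) (σ : SingularSimplex X (k + 1)) : SingularSimplex X k :=
  σ.comp ⟨stdSimplex.map i.succAbove, stdSimplex.continuous_map _⟩

theorem simplexInCoords_of_mem (σ : SingularSimplex X k) {t : Fin k → ℝ}
    (ht : t ∈ cornerSimplex k) : simplexInCoords σ t = σ (cornerToStd ⟨t, ht⟩) := dif_pos ht

theorem continuousOn_simplexInCoords (σ : SingularSimplex X k) :
    ContinuousOn (simplexInCoords σ) (cornerSimplex k) := by
  rw [continuousOn_iff_continuous_domRestrict]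
  have h : (cornerSimplex k).domRestrict (simplexInCoords σ) = fun t => σ (cornerToStd t) :=
    funext fun t => simplexInCoords_of_mem σ t.2
  rw [h]
  refine σ.continuous.comp (Continuous.subtype_mk (continuous_pi fun j => ?_) _)
  refine j.cases ?_ fun j => ?_
  · simp only [Fin.cons_zero]; fun_prop
  · exact (continuous_apply j).comp continuous_subtype_val

theorem cornerToStd_apply (t : cornerSimplex k) (j : Fin (k + 1)) :
    cornerToStd t j = (Fin.cons (1 - ∑ i, t.1 i) t.1 : Fin (k + 1) → ℝ) j := rfl

theorem cornerToStd_cornerFace (i : Fin (k + 2)) {t : Fin k → ℝ} (ht : t ∈ cornerSimplex k) :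
    cornerToStd ⟨cornerFace i t, cornerFace_mem i ht⟩ =
      stdSimplex.map i.succAbove (cornerToStd ⟨t, ht⟩) := by
  have hmap : ∀ (x : stdSimplex ℝ (Fin (k + 1))) (j : Fin (k + 1)),
      stdSimplex.map i.succAbove x (i.succAbove j) = x j := by
    intro x j
    simp only [stdSimplex.map_coe, FunOnFinite.linearMap_apply_apply]
    rw [Finset.sum_eq_single j] <;> simp +contextual
  have hmap' : ∀ (x : stdSimplex ℝ (Fin (k + 1))), stdSimplex.map i.succAbove x i = 0 := by
    intro x
    simp only [stdSimplex.map_coe, FunOnFinite.linearMap_apply_apply]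
    refine Finset.sum_eq_zero fun j hj => ?_
    simp at hj
  ext j
  refine i.succAboveCases ?_ (fun j => ?_) j
  · rw [hmap']
    refine i.cases ?_ fun i => ?_
    · simp [cornerToStd_apply, cornerFace_zero, Fin.sum_univ_succ]
    · simp [cornerToStd_apply, cornerFace_succ]
  · rw [hmap]
    refine i.cases ?_ fun i => ?_
    · refine j.cases ?_ fun j => ?_ <;> simp [cornerToStd_apply, cornerFace_zero]
    · refine j.cases ?_ fun j => ?_
      · simp [cornerToStd_apply, cornerFace_succ, i.sum_univ_succAbove]
      · simp [cornerToStd_apply, cornerFace_succ]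

theorem simplexInCoords_singularFace (i : Fin (k + 2)) (σ : SingularSimplex X (k + 1)) :
    EqOn (simplexInCoords (singularFace i σ)) (fun t => simplexInCoords σ (cornerFace i t))
      (cornerSimplex k) := by
  intro t ht
  rw [simplexInCoords_of_mem _ ht]
  simp only [simplexInCoords_of_mem σ (cornerFace_mem i ht), cornerToStd_cornerFace i ht]
  rfl

theorem simplexIncl_d (σ : SingularSimplex X (k + 1)) :
    simplexIncl σ ≫ (SingularChains X).d (k + 1) k =
      ∑ i : Fin (k + 2), (-1) ^ i.val • simplexIncl (singularFace i σ) :=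
  SSet.ιChainComplex_d (TopCat.toSSet.obj (TopCat.of X)) _ _

theorem d_simplexChain (σ : SingularSimplex X (k + 1)) :
    ((SingularChains X).d (k + 1) k).hom (simplexChain σ) =
      ∑ i : Fin (k + 2), (-1 : ℝ) ^ i.val • simplexChain (singularFace i σ) := by
  have h := congrArg (fun f => f.hom (ULift.up 1)) (simplexIncl_d σ)
  simp only [ModuleCat.hom_comp, LinearMap.comp_apply, ModuleCat.hom_sum, LinearMap.sum_apply] at h
  refine h.trans (Finset.sum_congr rfl fun i _ => ?_)
  rcases Nat.even_or_odd i.val with hi | hi <;> simp [hi.neg_one_pow, simplexChain]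

theorem simplexIncl_extendToChains (S : SingularSimplex X k → SingularSimplex X k)
    (σ : SingularSimplex X k) : simplexIncl σ ≫ extendToChains S = simplexIncl (S σ) :=
  (Sigma.ι_desc _ _).trans (by rw [Equiv.apply_symm_apply])

theorem simplexIncl_chainsMap {Y : Type u} [TopologicalSpace Y] (f : C(X, Y))
    (σ : SingularSimplex X k) : simplexIncl σ ≫ (chainsMap f).f k = simplexIncl (f.comp σ) :=
  SSet.ι_chainComplexMap_f _ _ _ _ _

theorem singularChains_hom_ext {T : ModuleCat.{u} ℝ} {f g : (SingularChains X).X k ⟶ T}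
    (h : ∀ σ : SingularSimplex X k, simplexIncl σ ≫ f = simplexIncl σ ≫ g) : f = g :=
  SSet.chainComplex_hom_ext fun x => by
    simpa [simplexIncl] using h (TopCat.toSSetObjEquiv (TopCat.of X) (.op ⦋k⦌) x)

/-- The morphism from `C_k(X, ℝ)` that is given by the morphisms `F σ` on the summands. -/
def chainsDesc {T : ModuleCat.{u} ℝ} (F : SingularSimplex X k → (RealCoeff.{u} ⟶ T)) :
    (SingularChains X).X k ⟶ T :=
  Sigma.desc fun x => F (TopCat.toSSetObjEquiv (TopCat.of X) (.op ⦋k⦌) x)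

theorem simplexIncl_chainsDesc {T : ModuleCat.{u} ℝ}
    (F : SingularSimplex X k → (RealCoeff.{u} ⟶ T)) (σ : SingularSimplex X k) :
    simplexIncl σ ≫ chainsDesc F = F σ :=
  (Sigma.ι_desc _ _).trans (by rw [Equiv.apply_symm_apply])

/-- The linear functional on chains with the values `F σ` on the simplices `σ`. -/
def chainsFunctional (F : SingularSimplex X k → ℝ) : (SingularChains X).X k →ₗ[ℝ] ℝ :=
  ULift.moduleEquiv.toLinearMap.comp
    (chainsDesc fun σ => (ModuleCat.ofHom (F σ • LinearMap.id) : RealCoeff.{u} ⟶ RealCoeff.{u})).hom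

theorem chainsFunctional_simplexChain (F : SingularSimplex X k → ℝ) (σ : SingularSimplex X k) :
    chainsFunctional F (simplexChain σ) = F σ := by
  have h := congrArg (fun f => (f.hom (ULift.up 1)).down) (simplexIncl_chainsDesc
    (fun σ => (ModuleCat.ofHom (F σ • LinearMap.id) : RealCoeff.{u} ⟶ RealCoeff.{u})) σ)
  refine h.trans ?_
  change F σ * 1 = F σ
  rw [mul_one]

theorem chainsFunctional_chainOf (F : SingularSimplex X k → ℝ) (c : SingularSimplex X k →₀ ℝ) :
    chainsFunctional F (chainOf c) = c.sum fun σ a => a * F σ := by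
  rw [chainOf, Finsupp.linearCombination_apply, Finsupp.sum, map_sum]
  simp [chainsFunctional_simplexChain, Finsupp.sum]

/-- The quotient map by the span of the simplices vanishes on every summand of the coproduct, hence
it is zero. -/
theorem chainOf_surjective : Function.Surjective (chainOf (X := X) (k := k)) := by
  set R := LinearMap.range (Finsupp.linearCombination ℝ (simplexChain (X := X) (k := k))) with hR
  have h : ModuleCat.ofHom R.mkQ = (0 : (SingularChains X).X k ⟶ ModuleCat.of ℝ (_ ⧸ R)) := by
    refine singularChains_hom_ext fun σ => ?_
    ext r
    have h1 : simplexChain σ ∈ R := ⟨Finsupp.single σ 1, by simp⟩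
    have h2 : (simplexIncl σ).hom r = r.down • simplexChain σ := by
      rw [simplexChain, ← map_smul]
      congr 1
      ext
      simp
    have h3 := (Submodule.Quotient.mk_eq_zero R).2 (R.smul_mem r.down h1)
    rw [← h2] at h3
    exact h3
  intro x
  have hx : R.mkQ x = 0 := congrArg (fun f => f.hom x) h
  rw [Submodule.mkQ_apply, Submodule.Quotient.mk_eq_zero] at hx
  exact hx

/-- Homology is the cokernel of the map from `(k + 1)`-chains to `k`-cycles, so a difference of
cycles that dies in homology comes from a chain. -/
theorem Represents.exists_boundary {c c' : SingularSimplex X k →₀ ℝ} {α : SingularHomology X k}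
    (hc : Represents c α) (hc' : Represents c' α) :
    ∃ b : (SingularChains X).X (k + 1),
      ((SingularChains X).d (k + 1) k).hom b = chainOf c - chainOf c' := by
  obtain ⟨z, hz, hzα⟩ := hc
  obtain ⟨z', hz', hzα'⟩ := hc'
  have hex := ShortComplex.exact_of_g_is_cokernel
    (ShortComplex.mk ((SingularChains X).toCycles (k + 1) k) ((SingularChains X).homologyπ k)
      (by simp)) ((SingularChains X).homologyIsCokernel (k + 1) k (by simp))
  obtain ⟨b, hb⟩ := (ShortComplex.moduleCat_exact_iff _).1 hex (z - z') (by
    change ((SingularChains X).homologyπ k).hom (z - z') = 0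
    rw [map_sub, hzα, hzα', sub_self])
  refine ⟨b, ?_⟩
  rw [← hz, ← hz', ← map_sub, ← hb, ← (SingularChains X).toCycles_i (k + 1) k]
  rfl

end SingularChains

/-! ### Integrals over `C¹` cycles that bound continuous chains -/

section Boundaries

variable {n : ℕ} {M : Type u} [TopologicalSpace M] [ChartedSpace (EuclideanSpace ℝ (Fin n)) M]
  {k : ℕ}

/-- The integral of a closed form over a `C¹` cycle that bounds a singular chain vanishes. -/
theorem FormField.IsClosedForm.sum_integralSimplex_eq_zero [IsManifold (𝓡 n) ∞ M] [T3Space M]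
    {η : FormField n M k} (hη : η.IsClosedForm) {c : SingularSimplex M k →₀ ℝ}
    (hc : ∀ σ ∈ c.support, IsC1Simplex n σ) {b : (SingularChains M).X (k + 1)}
    (hb : ((SingularChains M).d (k + 1) k).hom b = chainOf c) :
    (c.sum fun σ a => a * η.integralSimplex σ) = 0 := by
  obtain ⟨b, rfl⟩ := chainOf_surjective b
  obtain ⟨L, hL⟩ := exists_smoothingCharts_cover (n := n) (M := M)
    (b.support.isCompact_biUnion fun τ _ => isCompact_range τ.continuous)
  set F : ℕ → SingularSimplex M k → ℝ := fun m σ =>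
    η.integralMap (smoothAll L m (simplexInCoords σ)) with hF
  -- Only the simplices of `c` need to be `C¹` here. Other faces of `b` cancel in the boundary and
  -- play no role in the limit.
  have hlim : Tendsto (fun m => c.sum fun σ a => a * F m σ) atTop
      (𝓝 (c.sum fun σ a => a * η.integralSimplex σ)) :=
    tendsto_finsetSum _ fun σ hσ =>
      ((tendstoC1_smoothAll L (hc σ hσ)).tendsto_integralMap hη).const_mul _
  have hsmooth : ∀ᶠ m in atTop, ∀ τ ∈ b.support,
      ContMDiffOn 𝓘(ℝ, Fin (k + 1) → ℝ) (𝓡 n) ∞ (smoothAll L m (simplexInCoords τ))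
        (cornerSimplex (k + 1)) := by
    refine (Filter.eventually_all_finset _).2 fun τ hτ => ?_
    filter_upwards [eventually_contMDiffWithinAt_smoothAll L (continuousOn_simplexInCoords τ)]
      with m hm t ht
    refine hm t ht (hL _ (mem_iUnion₂.2 ⟨τ, hτ, ?_⟩))
    rw [simplexInCoords_of_mem τ ht]
    exact mem_range_self _
  -- As a functional on chains, `F m` is evaluated on `∂b` simplex by simplex. Smoothing commutes
  -- with faces, so Stokes' theorem for each smoothed simplex of `b` gives zero.
  have hzero : ∀ᶠ m in atTop, (c.sum fun σ a => a * F m σ) = 0 := by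
    filter_upwards [hsmooth, eventually_ne_atTop 0] with m hm hm0
    rw [← chainsFunctional_chainOf, ← hb, chainOf, Finsupp.linearCombination_apply, Finsupp.sum,
      map_sum, map_sum]
    refine Finset.sum_eq_zero fun τ hτ => ?_
    rw [map_smul, map_smul, d_simplexChain, map_sum]
    simp only [map_smul, chainsFunctional_simplexChain, smul_eq_mul]
    refine mul_eq_zero_of_right _ ?_
    rw [← hη.sum_integralMap_cornerFace_eq_zero (hm τ hτ)]
    refine Finset.sum_congr rfl fun i _ => ?_
    congr 1
    refine η.integralMap_congr fun t ht => ?_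
    rw [smoothAll_cornerFace L hm0]
    exact smoothAll_congr L (simplexInCoords_singularFace i τ) ht
  exact tendsto_nhds_unique hlim (tendsto_const_nhds.congr' (hzero.mono fun m hm => hm.symm))

theorem FormField.IsClosedForm.sum_integralSimplex_eq [IsManifold (𝓡 n) ∞ M] [T3Space M]
    {η : FormField n M k} (hη : η.IsClosedForm) {c c' : SingularSimplex M k →₀ ℝ}
    (hc : ∀ σ ∈ c.support, IsC1Simplex n σ) (hc' : ∀ σ ∈ c'.support, IsC1Simplex n σ)
    {b : (SingularChains M).X (k + 1)}
    (hb : ((SingularChains M).d (k + 1) k).hom b = chainOf c - chainOf c') :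
    (c.sum fun σ a => a * η.integralSimplex σ) = c'.sum fun σ a => a * η.integralSimplex σ := by
  classical
  rw [← sub_eq_zero, ← Finsupp.sum_sub_index fun σ a b => sub_mul a b _]
  refine hη.sum_integralSimplex_eq_zero (b := b) (fun σ hσ => ?_) ?_
  · rcases Finset.mem_union.1 (Finsupp.support_sub hσ) with h | h
    exacts [hc σ h, hc' σ h]
  · rw [hb, chainOf, chainOf, chainOf, map_sub]

end Boundaries

/-! ### Lifts of singular simplices to the universal cover -/

section Lifts

theorem IsCoveringMap.surjective_of_pathConnectedSpace {M N : Type*} [TopologicalSpace M]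
    [TopologicalSpace N] [PathConnectedSpace M] [Nonempty N] {p : N → M} (hp : IsCoveringMap p) :
    Function.Surjective p := by
  intro y
  obtain ⟨x⟩ := ‹Nonempty N›
  let γ := PathConnectedSpace.somePath (p x) y
  obtain ⟨Γ, hΓ, -⟩ := hp.exists_path_lifts γ.toContinuousMap x (by simp)
  refine ⟨Γ 1, ?_⟩
  have := congrFun hΓ 1
  simpa using this

instance (k : ℕ) : ContractibleSpace (stdSimplex ℝ (Fin (k + 1))) :=
  (convex_stdSimplex ℝ _).contractibleSpace ⟨_, (stdSimplex.vertex 0).2⟩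

instance (k : ℕ) : LocallyPathConnectedSpace (stdSimplex ℝ (Fin (k + 1))) :=
  (convex_stdSimplex ℝ _).locallyPathConnectedSpace

variable {M N : Type u} [TopologicalSpace M] [TopologicalSpace N] {k : ℕ}

theorem IsCoveringMap.exists_singularSimplex_lift [PathConnectedSpace M] [Nonempty N] {p : C(N, M)}
    (hp : IsCoveringMap p) (σ : SingularSimplex M k) :
    ∃ τ : SingularSimplex N k, p.comp τ = σ := by
  obtain ⟨x, hx⟩ := hp.surjective_of_pathConnectedSpace (σ (stdSimplex.vertex 0))
  obtain ⟨τ, ⟨-, hτ⟩, -⟩ := hp.existsUnique_continuousMap_lifts σ (stdSimplex.vertex 0) x hx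
  exact ⟨τ, ContinuousMap.ext fun t => congrFun hτ t⟩

variable [SimplyConnectedSpace N] [LocallyPathConnectedSpace N]

/-- As `N` is simply connected, `p` lifts through itself with `x ↦ y` and with `y ↦ x`; by
uniqueness of lifts these two maps are inverse to each other. -/
theorem IsCoveringMap.exists_mem_deckGroup {p : C(N, M)} (hp : IsCoveringMap p) {x y : N}
    (hxy : p x = p y) : ∃ γ ∈ deckGroup p, γ x = y := by
  obtain ⟨F, ⟨hF, hpF⟩, -⟩ := hp.existsUnique_continuousMap_lifts p x y hxy.symm
  obtain ⟨G, ⟨hG, hpG⟩, -⟩ := hp.existsUnique_continuousMap_lifts p y x hxy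
  have hGF : G ∘ F = id := hp.eq_of_comp_eq (G.continuous.comp F.continuous) continuous_id
    (by rw [← Function.comp_assoc, hpG, hpF]; rfl) x (by simp [hF, hG])
  have hFG : F ∘ G = id := hp.eq_of_comp_eq (F.continuous.comp G.continuous) continuous_id
    (by rw [← Function.comp_assoc, hpF, hpG]; rfl) y (by simp [hF, hG])
  exact ⟨⟨⟨F, G, congrFun hGF, congrFun hFG⟩, F.continuous, G.continuous⟩,
    fun z => congrFun hpF z, hF⟩

theorem IsCoveringMap.exists_deck_comp_eq {p : C(N, M)} (hp : IsCoveringMap p)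
    {τ τ' : SingularSimplex N k} (h : p.comp τ = p.comp τ') :
    ∃ γ ∈ deckGroup p, (γ : C(N, N)).comp τ = τ' := by
  obtain ⟨γ, hγ, hx⟩ := hp.exists_mem_deckGroup (DFunLike.congr_fun h (stdSimplex.vertex 0))
  refine ⟨γ, hγ, DFunLike.coe_injective (hp.eq_of_comp_eq (map_continuous _) (map_continuous _) ?_
    (stdSimplex.vertex 0) hx)⟩
  funext t
  exact (hγ _).trans (DFunLike.congr_fun h t)

end Lifts

/-! ### Descent of equivariant maps of chains -/

section Descent

variable {M N : Type u} [TopologicalSpace M] [TopologicalSpace N] {k : ℕ}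

theorem chainsMap_comp_deck {p : C(N, M)} {γ : N ≃ₜ N} (hγ : γ ∈ deckGroup p) :
    (chainsMap (γ : C(N, N))).f k ≫ (chainsMap p).f k = (chainsMap p).f k :=
  singularChains_hom_ext fun σ => by
    rw [← Category.assoc, simplexIncl_chainsMap, simplexIncl_chainsMap, simplexIncl_chainsMap]
    congr 1
    exact ContinuousMap.ext fun t => hγ _

theorem deck_comp_extendToChains {S : SingularSimplex N k → SingularSimplex N k} {γ : C(N, N)}
    (h : ∀ σ, S (γ.comp σ) = γ.comp (S σ)) :
    (chainsMap γ).f k ≫ extendToChains S = extendToChains S ≫ (chainsMap γ).f k :=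
  singularChains_hom_ext fun σ => by
    rw [← Category.assoc, simplexIncl_chainsMap, simplexIncl_extendToChains, ← Category.assoc,
      simplexIncl_extendToChains, simplexIncl_chainsMap, h]

/-- A lift of each singular simplex to the covering space. -/
def simplexLift [PathConnectedSpace M] [Nonempty N] {p : C(N, M)} (hp : IsCoveringMap p)
    (σ : SingularSimplex M k) : SingularSimplex N k :=
  (hp.exists_singularSimplex_lift σ).choose

theorem comp_simplexLift [PathConnectedSpace M] [Nonempty N] {p : C(N, M)} (hp : IsCoveringMap p)
    (σ : SingularSimplex M k) : p.comp (simplexLift hp σ) = σ :=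
  (hp.exists_singularSimplex_lift σ).choose_spec

/-- The map of chains of the base that is given by a map of chains of the covering space. -/
def chainsDescend [PathConnectedSpace M] [Nonempty N] {p : C(N, M)} (hp : IsCoveringMap p)
    {T : ModuleCat.{u} ℝ} (f : (SingularChains N).X k ⟶ T) : (SingularChains M).X k ⟶ T :=
  chainsDesc fun σ => simplexIncl (simplexLift hp σ) ≫ f

/-- Chains of `M` are the coinvariants of chains of `N`: two lifts of a simplex differ by a deck
transformation, so an invariant map does not see which lift was chosen. -/
theorem chainsMap_chainsDescend [PathConnectedSpace M] [SimplyConnectedSpace N]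
    [LocallyPathConnectedSpace N] {p : C(N, M)} (hp : IsCoveringMap p) {T : ModuleCat.{u} ℝ}
    {f : (SingularChains N).X k ⟶ T}
    (hf : ∀ γ ∈ deckGroup p, (chainsMap (γ : C(N, N))).f k ≫ f = f) :
    (chainsMap p).f k ≫ chainsDescend hp f = f :=
  singularChains_hom_ext fun τ => by
    obtain ⟨γ, hγ, h⟩ := hp.exists_deck_comp_eq (comp_simplexLift hp (p.comp τ)).symm
    rw [← Category.assoc, simplexIncl_chainsMap, chainsDescend, simplexIncl_chainsDesc, ← h,
      ← simplexIncl_chainsMap, Category.assoc, hf γ hγ]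

theorem chainsMap_cancel [PathConnectedSpace M] [Nonempty N] {p : C(N, M)} (hp : IsCoveringMap p)
    {T : ModuleCat.{u} ℝ} {f g : (SingularChains M).X k ⟶ T}
    (h : (chainsMap p).f k ≫ f = (chainsMap p).f k ≫ g) : f = g :=
  singularChains_hom_ext fun σ => by
    rw [← comp_simplexLift hp σ, ← simplexIncl_chainsMap, Category.assoc, h, Category.assoc]

theorem chainOf_mapDomain_straighten [PathConnectedSpace M] [Nonempty N] {p : C(N, M)}
    (hp : IsCoveringMap p)
    (S : SingularSimplex N k → SingularSimplex N k) (c : SingularSimplex M k →₀ ℝ) :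
    (chainsDescend hp (extendToChains S ≫ (chainsMap p).f k)).hom (chainOf c) =
      chainOf (c.mapDomain fun σ => p.comp (S (simplexLift hp σ))) := by
  rw [chainOf, chainOf, Finsupp.linearCombination_mapDomain, Finsupp.linearCombination_apply,
    Finsupp.linearCombination_apply, Finsupp.sum, Finsupp.sum, map_sum]
  refine Finset.sum_congr rfl fun σ _ => ?_
  rw [map_smul]
  congr 1
  have h : simplexIncl σ ≫ chainsDescend hp (extendToChains S ≫ (chainsMap p).f k) =
      simplexIncl (p.comp (S (simplexLift hp σ))) := by
    rw [chainsDescend, simplexIncl_chainsDesc, ← Category.assoc, simplexIncl_extendToChains,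
      simplexIncl_chainsMap]
  exact congrArg (fun f => f.hom (ULift.up 1)) h

variable [PathConnectedSpace M] [SimplyConnectedSpace N] [LocallyPathConnectedSpace N]

/-- The homotopy identity `S - id = ∂H + H∂` descends to `M`, where it can be checked after the
surjection from chains of `N`. On a cycle the term `H∂` vanishes. -/
theorem IsStraightening.exists_boundary {n : ℕ} {p : C(N, M)} (hp : IsCoveringMap p)
    {S : ∀ k : ℕ, SingularSimplex N k → SingularSimplex N k} (hS : IsStraightening n p S)
    (hk : k ≤ n) {c : SingularSimplex M k →₀ ℝ} {α : SingularHomology M k}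
    (hc : Represents c α) :
    ∃ b : (SingularChains M).X (k + 1), ((SingularChains M).d (k + 1) k).hom b =
      chainOf (c.mapDomain fun σ => p.comp (S k (simplexLift hp σ))) - chainOf c := by
  obtain ⟨z, hz, -⟩ := hc
  obtain ⟨H, hHγ, hH0, hH⟩ := hS.homotopy
  have hT : (chainsMap p).f k ≫ chainsDescend hp (extendToChains (S k) ≫ (chainsMap p).f k) =
      extendToChains (S k) ≫ (chainsMap p).f k :=
    chainsMap_chainsDescend hp fun γ hγ => by
      rw [← Category.assoc, deck_comp_extendToChains (hS.equivariant k hk γ hγ), Category.assoc,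
        chainsMap_comp_deck hγ]
  have hdesc : ∀ l ≤ n, (chainsMap p).f l ≫ chainsDescend hp (H l ≫ (chainsMap p).f (l + 1)) =
      H l ≫ (chainsMap p).f (l + 1) := fun l hl =>
    chainsMap_chainsDescend hp fun γ hγ => by
      rw [← Category.assoc, hHγ l hl γ hγ, Category.assoc, chainsMap_comp_deck hγ]
  refine ⟨(chainsDescend hp (H k ≫ (chainsMap p).f (k + 1))).hom (chainOf c), ?_⟩
  rw [← chainOf_mapDomain_straighten hp (S k) c]
  suffices h : ((SingularChains M).iCycles k ≫
      (chainsDescend hp (extendToChains (S k) ≫ (chainsMap p).f k) - 𝟙 _)) =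
      (SingularChains M).iCycles k ≫ chainsDescend hp (H k ≫ (chainsMap p).f (k + 1)) ≫
        (SingularChains M).d (k + 1) k by
    have := congrArg (fun f => f.hom z) h
    rw [← hz]
    exact this.symm
  cases k with
  | zero =>
    congr 1
    refine chainsMap_cancel hp ?_
    rw [Preadditive.comp_sub, hT, Category.comp_id, ← Category.assoc _ _ ((SingularChains M).d _ _),
      hdesc 0 hk, Category.assoc, (chainsMap p).comm, ← Category.assoc, ← hH0,
      Preadditive.sub_comp, Category.id_comp]
  | succ k =>
    have key : chainsDescend hp (extendToChains (S (k + 1)) ≫ (chainsMap p).f (k + 1)) - 𝟙 _ =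
        (SingularChains M).d (k + 1) k ≫ chainsDescend hp (H k ≫ (chainsMap p).f (k + 1)) +
        chainsDescend hp (H (k + 1) ≫ (chainsMap p).f (k + 1 + 1)) ≫
          (SingularChains M).d (k + 1 + 1) (k + 1) := by
      refine chainsMap_cancel hp ?_
      rw [Preadditive.comp_sub, hT, Category.comp_id, Preadditive.comp_add,
        ← Category.assoc _ _ ((SingularChains M).d (k + 1 + 1) (k + 1)), hdesc (k + 1) hk,
        Category.assoc _ _ ((SingularChains M).d (k + 1 + 1) (k + 1)), (chainsMap p).comm,
        ← Category.assoc _ ((SingularChains M).d (k + 1) k), (chainsMap p).comm,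
        Category.assoc, hdesc k (by omega), ← Category.assoc, ← Category.assoc,
        ← Preadditive.add_comp, ← hH k hk, Preadditive.sub_comp, Category.id_comp]
    rw [key, Preadditive.comp_add, ← Category.assoc, HomologicalComplex.iCycles_d, zero_comp,
      zero_add]

end Descent

/-! ### Comass and volume -/

section Volume

theorem AlternatingMap.map_sum_smul_eq_det_mul {V : Type*} [AddCommGroup V] [Module ℝ V] {k : ℕ}
    (φ : V [⋀^Fin k]→ₗ[ℝ] ℝ) (A : Matrix (Fin k) (Fin k) ℝ) (u : Fin k → V) :
    φ (fun i => ∑ j, A i j • u j) = A.det * φ u := by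
  have h := (φ.compLinearMap (Fintype.linearCombination ℝ u)).eq_smul_basis_det
    (Pi.basisFun ℝ (Fin k))
  have h1 := DFunLike.congr_fun h (fun i => A i)
  simp only [AlternatingMap.compLinearMap_apply, AlternatingMap.smul_apply,
    Fintype.linearCombination_apply, Pi.basisFun_det_apply, smul_eq_mul] at h1
  rw [h1, mul_comm]
  congr 2
  ext i
  simp [Pi.single_apply]

/-- For independent `w`, Gram–Schmidt gives `w = A u` with `u` orthonormal. Then `φ w = det A · φ
u`, while the Gram matrix is `A Aᵀ` with determinant `(det A)²`. For dependent `w` the left side is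
zero. -/
theorem AlternatingMap.abs_apply_le_sqrt_det_gram {V : Type*} [NormedAddCommGroup V]
    [InnerProductSpace ℝ V] {k : ℕ} (φ : V [⋀^Fin k]→ₗ[ℝ] ℝ)
    (hφ : ∀ v : Fin k → V, (∀ i, ‖v i‖ = 1) → |φ v| ≤ 1) (w : Fin k → V) :
    |φ w| ≤ √(Matrix.of fun i j : Fin k => (inner ℝ (w i) (w j) : ℝ)).det := by
  by_cases hw : LinearIndependent ℝ w
  · have ho := InnerProductSpace.gramSchmidtNormed_orthonormal (𝕜 := ℝ) hw
    set u := InnerProductSpace.gramSchmidtNormed ℝ w with hu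
    have hspan : ∀ i, ∃ a : Fin k → ℝ, ∑ j, a j • u j = w i := fun i => by
      rw [← Submodule.mem_span_range_iff_exists_fun, hu,
        InnerProductSpace.span_gramSchmidtNormed_range, InnerProductSpace.span_gramSchmidt]
      exact Submodule.subset_span (mem_range_self i)
    choose A hA using hspan
    have hgram : (Matrix.of fun i j : Fin k => (inner ℝ (w i) (w j) : ℝ)) =
        Matrix.of A * (Matrix.of A).transpose := by
      ext i j
      rw [Matrix.of_apply, ← hA i, ← hA j, ho.inner_sum]
      simp [Matrix.mul_apply]
    have h1 : φ w = (Matrix.of A).det * φ u := by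
      rw [← φ.map_sum_smul_eq_det_mul]
      congr 1
      exact funext fun i => (hA i).symm
    rw [hgram, Matrix.det_mul, Matrix.det_transpose, Real.sqrt_mul_self_eq_abs, h1, abs_mul]
    exact mul_le_of_le_one_right (abs_nonneg _) (hφ u ho.norm_eq_one)
  · rw [φ.map_linearDependent w hw, abs_zero]
    exact Real.sqrt_nonneg _

variable {n : ℕ} {M N : Type u} [TopologicalSpace M] [ChartedSpace (EuclideanSpace ℝ (Fin n)) M]
  [TopologicalSpace N] [ChartedSpace (EuclideanSpace ℝ (Fin n)) N] {k : ℕ}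

theorem simplexInCoords_comp {X Y : Type u} [TopologicalSpace X] [TopologicalSpace Y] (f : C(X, Y))
    (σ : SingularSimplex X k) : simplexInCoords (f.comp σ) = fun t => f (simplexInCoords σ t) := by
  funext t
  by_cases ht : t ∈ cornerSimplex k <;> simp [simplexInCoords, ht]

theorem IsC1Simplex.comp [IsManifold (𝓡 n) ∞ M] [IsManifold (𝓡 n) ∞ N] {p : C(N, M)}
    (hp : ContMDiff (𝓡 n) (𝓡 n) ∞ p) {σ : SingularSimplex N k} (hσ : IsC1Simplex n σ) :
    IsC1Simplex n (p.comp σ) := by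
  rw [IsC1Simplex, simplexInCoords_comp]
  exact (hp.of_le (by exact_mod_cast le_top)).comp_contMDiffOn hσ

variable [RiemannianBundle (fun x : M => TangentSpace (𝓡 n) x)]
  [RiemannianBundle (fun x : N => TangentSpace (𝓡 n) x)]

theorem FormField.abs_apply_le_of_comass_le_one {η : FormField n M k} (hη : η.comass ≤ 1) (x : M)
    (w : Fin k → TangentSpace (𝓡 n) x) :
    |η x w| ≤ √(Matrix.of fun i j : Fin k => (inner ℝ (w i) (w j) : ℝ)).det := by
  refine (η x).toAlternatingMap.abs_apply_le_sqrt_det_gram (fun v hv => ?_) w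
  have h : ‖η x v‖ₑ ≤ 1 := by
    refine le_trans ?_ hη
    rw [FormField.comass]
    exact le_iSup_of_le x (le_iSup_of_le v (le_iSup_of_le hv le_rfl))
  have h2 : ‖η x v‖ ≤ 1 := by
    rw [← ofReal_norm, ENNReal.ofReal_le_one] at h
    exact h
  exact h2

theorem FormField.enorm_integralSimplex_comp_le {η : FormField n M k} (hη : η.comass ≤ 1)
    {p : C(N, M)} (hp : ContMDiff (𝓡 n) (𝓡 n) ∞ p)
    (hiso : ∀ (x : N) (v : TangentSpace (𝓡 n) x), ‖mfderiv (𝓡 n) (𝓡 n) p x v‖ = ‖v‖)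
    {σ : SingularSimplex N k} (hσ : IsC1Simplex n σ) :
    ‖η.integralSimplex (p.comp σ)‖ₑ ≤ simplexVolume n σ := by
  rw [η.integralSimplex_eq_integralMap, simplexInCoords_comp, FormField.integralMap, simplexVolume]
  refine (enorm_integral_le_lintegral_enorm _).trans
    (setLIntegral_mono' (isClosed_cornerSimplex k).measurableSet fun t ht => ?_)
  have h1 := mfderiv_comp_mfderivWithin t
    ((hp.contMDiffAt (x := simplexInCoords σ t)).mdifferentiableAt (by simp))
    ((hσ t ht).mdifferentiableWithinAt (by simp))
    (uniqueMDiffWithinAt_iff_uniqueDiffWithinAt.2 (uniqueDiffOn_cornerSimplex k t ht))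
  have h2 : (η.pullback (fun t => p (simplexInCoords σ t)) t fun i => Pi.single i 1) =
      η (p (simplexInCoords σ t)) fun i =>
        mfderiv (𝓡 n) (𝓡 n) p (simplexInCoords σ t) (simplexTangent n σ t i) :=
    congrArg (η (p (simplexInCoords σ t)))
      (funext fun i => DFunLike.congr_fun h1 (Pi.single i (1 : ℝ) : Fin k → ℝ))
  -- Polarisation: a linear map that preserves norms preserves inner products, hence the Gram
  -- determinant.
  have hinner : ∀ v w : TangentSpace (𝓡 n) (simplexInCoords σ t),
      (inner ℝ (mfderiv (𝓡 n) (𝓡 n) p (simplexInCoords σ t) v)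
        (mfderiv (𝓡 n) (𝓡 n) p (simplexInCoords σ t) w) : ℝ) = inner ℝ v w := by
    intro v w
    rw [real_inner_eq_norm_add_mul_self_sub_norm_mul_self_sub_norm_mul_self_div_two, ← map_add,
      hiso, hiso, hiso, ← real_inner_eq_norm_add_mul_self_sub_norm_mul_self_sub_norm_mul_self_div_two]
  rw [h2, ← ofReal_norm, Real.norm_eq_abs]
  refine ENNReal.ofReal_le_ofReal ((FormField.abs_apply_le_of_comass_le_one hη _ _).trans ?_)
  simp only [hinner]
  rfl

end Volume

/-- The integral of a closed form over a homology class, computed by straightening a singular cycle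
that represents the class. -/
theorem FormField.IsClosedForm.sum_integralSimplex_straighten {n : ℕ} {M N : Type u}
    [TopologicalSpace M] [ChartedSpace (EuclideanSpace ℝ (Fin n)) M] [IsManifold (𝓡 n) ∞ M]
    [T3Space M] [PathConnectedSpace M] [TopologicalSpace N]
    [ChartedSpace (EuclideanSpace ℝ (Fin n)) N] [IsManifold (𝓡 n) ∞ N] [SimplyConnectedSpace N]
    [LocallyPathConnectedSpace N] {k : ℕ} {η : FormField n M k} (hη : η.IsClosedForm)
    {p : C(N, M)} (hp : IsCoveringMap p) (hsm : ContMDiff (𝓡 n) (𝓡 n) ∞ p)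
    {S : ∀ k : ℕ, SingularSimplex N k → SingularSimplex N k} (hS : IsStraightening n p S)
    (hk : k ≤ n) (hC1 : ∀ σ : SingularSimplex N k, IsC1Simplex n (S k σ))
    {c c₀ : SingularSimplex M k →₀ ℝ} {α : SingularHomology M k} (hc : Represents c α)
    (hc₀ : ∀ σ ∈ c₀.support, IsC1Simplex n σ) (hc₀α : Represents c₀ α) :
    (c.sum fun σ a => a * η.integralSimplex (p.comp (S k (simplexLift hp σ)))) =
      c₀.sum fun σ a => a * η.integralSimplex σ := by
  classical
  obtain ⟨b, hb⟩ := hS.exists_boundary hp hk hc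
  obtain ⟨b', hb'⟩ := hc.exists_boundary hc₀α
  -- `b` joins the straightened cycle to `c`, and `b'` joins `c` to `c₀`; the intermediate cycle `c`
  -- need not be `C¹`.
  rw [← hη.sum_integralSimplex_eq (b := b + b') (fun σ hσ => ?_) hc₀
      (by rw [map_add, hb, hb', sub_add_sub_cancel]),
    Finsupp.sum_mapDomain_index (by simp) (fun σ a a' => add_mul a a' _)]
  obtain ⟨τ, -, rfl⟩ := Finset.mem_image.1 (Finsupp.mapDomain_support hσ)
  exact (hC1 _).comp hsm

theorem mainTheorem5 {n : ℕ}
    {M : Type u} [MetricSpace M] [CompleteSpace M] [ConnectedSpace M]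
    [ChartedSpace (EuclideanSpace ℝ (Fin n)) M] [IsManifold (𝓡 n) ∞ M]
    [RiemannianBundle (fun x : M => TangentSpace (𝓡 n) x)]
    [IsContMDiffRiemannianBundle (𝓡 n) ∞ (EuclideanSpace ℝ (Fin n))
      (fun x : M => TangentSpace (𝓡 n) x)]
    [IsRiemannianManifold (𝓡 n) M]
    {N : Type u} [TopologicalSpace N]
    [ChartedSpace (EuclideanSpace ℝ (Fin n)) N] [IsManifold (𝓡 n) ∞ N]
    [RiemannianBundle (fun x : N => TangentSpace (𝓡 n) x)]
    [IsContMDiffRiemannianBundle (𝓡 n) ∞ (EuclideanSpace ℝ (Fin n))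
      (fun x : N => TangentSpace (𝓡 n) x)]
    (p : N → M) (hp : IsRiemannianUniversalCover n p)
    (S : ∀ k : ℕ, SingularSimplex N k → SingularSimplex N k) (hS : IsStraightening n p S)
    (k : ℕ) (hk : k ≤ n) (C : ℝ) (hC : 0 < C)
    (hC1 : ∀ σ : SingularSimplex N k, IsC1Simplex n (S k σ))
    (hvol : ∀ σ : SingularSimplex N k, simplexVolume n (S k σ) ≤ ENNReal.ofReal C)
    (α : SingularHomology M k) :
    ENNReal.ofReal (1 / C) * mass n α ≤ gromovNorm α := by
  have hn : SimplyConnectedSpace N := hp.simplyConnected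
  have : LocallyPathConnectedSpace M :=
    ChartedSpace.locallyPathConnectedSpace (EuclideanSpace ℝ (Fin n)) M
  have : LocallyPathConnectedSpace N :=
    ChartedSpace.locallyPathConnectedSpace (EuclideanSpace ℝ (Fin n)) N
  have : PathConnectedSpace M := pathConnectedSpace_iff_connectedSpace.2 inferInstance
  obtain ⟨q, rfl⟩ : ∃ q : C(N, M), ⇑q = p := ⟨⟨p, hp.smooth.continuous⟩, rfl⟩
  refine le_iInf₂ fun c hc => ?_
  suffices h : mass n α ≤ ENNReal.ofReal C * ENNReal.ofReal (c.sum fun _ a => |a|) by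
    calc ENNReal.ofReal (1 / C) * mass n α
        ≤ ENNReal.ofReal (1 / C) *
          (ENNReal.ofReal C * ENNReal.ofReal (c.sum fun _ a => |a|)) := by gcongr
      _ = ENNReal.ofReal (c.sum fun _ a => |a|) := by
        rw [← mul_assoc, ← ENNReal.ofReal_mul (by positivity), one_div_mul_cancel hC.ne',
          ENNReal.ofReal_one, one_mul]
  rw [← ENNReal.ofReal_mul hC.le]
  refine iSup₂_le fun η hη => iSup₂_le fun hη1 r => iSup_le fun hr =>
    ENNReal.ofReal_le_ofReal ?_
  obtain ⟨c₀, hc₀, hc₀α, rfl⟩ := hr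
  -- The sum still runs over the simplices of `c` with their own coefficients, so the bound by `C`
  -- for each straightened simplex yields `C ∑ |a_i|` term by term.
  rw [← hη.sum_integralSimplex_straighten hp.isCoveringMap hp.smooth hS hk hC1 hc hc₀ hc₀α,
    Finsupp.sum, Finsupp.sum, Finset.mul_sum]
  refine Finset.sum_le_sum fun σ _ => ?_
  have h : ‖η.integralSimplex (q.comp (S k (simplexLift hp.isCoveringMap σ)))‖ₑ ≤
      ENNReal.ofReal C :=
    (FormField.enorm_integralSimplex_comp_le hη1 hp.smooth hp.isometric (hC1 _)).trans (hvol _)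
  rw [← ofReal_norm, ENNReal.ofReal_le_ofReal_iff hC.le, Real.norm_eq_abs] at h
  refine (le_abs_self _).trans ?_
  rw [abs_mul, mul_comm]
  exact mul_le_mul_of_nonneg_right h (abs_nonneg _)
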